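/- Let $W$ be a standard $n$-dimensional Wiener process on a probability space, let $L,B\in\mathbb{R}^{n\times n}$ with $L$ (symmetric) negative semidefinite, and let $X$ be a solution of $dX_t = LX_t\,dt + B\,dW_t$ with initial value $X_0$. For $k\ge 1$ put $\lambda_k=(k-\tfrac12)\pi$, $$\varphi^{\cos}_{k,t}(z)=\frac{z e^{zt}-z\cos(\lambda_k t)+\lambda_k\sin(\lambda_k t)}{z^2+\lambda_k^2},\qquad Z_k=\sqrt2\,\lambda_k\int_0^1\sin(\lambda_k s)\,W_s\,ds,$$ so that the $Z_k$ are the coefficients in the Karhunen–Loève expansion $W_t=\sqrt2\sum_{k\ge1}Z_k\sin(\lambda_k t)/\lambda_k$ of $W$ on $[0,1]$. For $m\ge 0$ let $$X_t^m=e^{tL}X_0+\sqrt2\sum_{k=1}^m\varphi^{\cos}_{k,t}(L)\,B\,Z_k$$ be the $m$-term truncation of the series representation of $X_t$. Then, for every $t\in[0,1]$ and every $m\ge0$, the random variable $\|X_t-X_t^m\|^2$ is integrable and $$\mathbb{E}\,\|X_t-X_t^m\|^2 = 2\sum_{k=m+1}^\infty\bigl\|\varphi^{\cos}_{k,t}(L)B\bigr\|_F^2,$$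 with a convergent series on the right, and, if $m\ge2$, $$\mathbb{E}\,\|X_t-X_t^m\|^2\le\frac{2\|B\|^2}{\pi^2}\,\frac{n}{m-1}.$$ Here $\|\cdot\|_F$ is the Frobenius norm, and $\|\cdot\|$ is the Euclidean norm of vectors and the spectral norm of matrices. In particular, $\mathbb{E}\,\|X_t-X_t^m\|^2=O(1/m)$ as $m\to\infty$. -/

import Mathlib

open MeasureTheory ProbabilityTheory Filter
open scoped NNReal

noncomputable section

namespace SDEKarhunenLoeve

/-- The product `A v` of a matrix and a vector of the Euclidean space `ℝⁿ`. -/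
def act {n : ℕ} (A : Matrix (Fin n) (Fin n) ℝ) (v : EuclideanSpace ℝ (Fin n)) :
    EuclideanSpace ℝ (Fin n) :=
  WithLp.toLp 2 (A.mulVec v.ofLp)

open scoped Matrix.Norms.L2Operator in
/-- The spectral norm `‖A‖`: the operator norm for the Euclidean norm on `ℝⁿ`. -/
def euclOpNorm {n : ℕ} (A : Matrix (Fin n) (Fin n) ℝ) : ℝ := ‖A‖

open scoped Matrix.Norms.Frobenius in
/-- The Frobenius norm `‖A‖_F`. -/
def frobeniusNorm {n : ℕ} (A : Matrix (Fin n) (Fin n) ℝ) : ℝ := ‖A‖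

/-- `L` is negative semidefinite: it is symmetric and `xᵀ L x ≤ 0` for all `x`. -/
def NegSemidef {n : ℕ} (L : Matrix (Fin n) (Fin n) ℝ) : Prop := (-L).PosSemidef

/-- The frequencies `λ_k = (k - 1/2) π` of the Karhunen–Loève expansion of the Wiener process
on `[0, 1]`; they are used for `k ≥ 1`. -/
def freq (k : ℕ) : ℝ := ((k : ℝ) - 1 / 2) * Real.pi

/-- The trigonometric `φ` function `φ_{k,t}^{cos}` of a matrix, that is, the entire function
`z ↦ (z e^{zt} - z cos (λ_k t) + λ_k sin (λ_k t)) / (z² + λ_k²)` evaluated at `A`.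
The matrix `A² + λ_k²` is invertible unless `± i λ_k` is an eigenvalue of `A`; in particular it is
invertible for every negative semidefinite `A`. -/
def phiCos {n : ℕ} (k : ℕ) (t : ℝ) (A : Matrix (Fin n) (Fin n) ℝ) : Matrix (Fin n) (Fin n) ℝ :=
  (A * NormedSpace.exp (t • A) - Real.cos (freq k * t) • A
      + (freq k * Real.sin (freq k * t)) • (1 : Matrix (Fin n) (Fin n) ℝ))
    * (A ^ 2 + freq k ^ 2 • (1 : Matrix (Fin n) (Fin n) ℝ))⁻¹

variable {Ω : Type*} [MeasurableSpace Ω]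

/-- `W` is a standard `n`-dimensional Wiener process on `[0, ∞)`: its coordinates are independent
standard real Brownian motions (with almost surely continuous paths). -/
structure IsWienerProcess {n : ℕ} (W : ℝ≥0 → Ω → EuclideanSpace ℝ (Fin n)) (P : Measure Ω) :
    Prop where
  brownian : ∀ i, IsBrownianReal (fun t ω => W t ω i) P
  indep : iIndepFun (fun (i : Fin n) ω (t : ℝ≥0) => W t ω i) P

/-- `X` solves the stochastic differential equation `dX = L X dt + B dW` with the (arbitrary)
initial value `X 0`: almost surely `X` has continuous paths and
`X_t = X_0 + ∫_0^t L X_s ds + ∫_0^t B dW_s` for all `t ≥ 0`. The integrand of the stochastic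
integral is constant, so that the Itô sums telescope to the integral `B (W_t - W_0)`. -/
def IsSolution {n : ℕ} (L B : Matrix (Fin n) (Fin n) ℝ)
    (W X : ℝ≥0 → Ω → EuclideanSpace ℝ (Fin n)) (P : Measure Ω) : Prop :=
  ∀ᵐ ω ∂P, Continuous (fun t => X t ω) ∧
    ∀ t : ℝ≥0, X t ω = X 0 ω + (∫ s in (0 : ℝ)..t, act L (X s.toNNReal ω))
      + act B (W t ω - W 0 ω)

/-- The random vectors `Z_k`, `k ≥ 1`, in the Karhunen–Loève expansion
`W_t = √2 ∑_{k ≥ 1} Z_k sin (λ_k t) / λ_k`, `0 ≤ t ≤ 1`. They are the normalized coefficients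
`Z_k = λ_k ∫_0^1 √2 sin (λ_k s) W_s ds` of `W` with respect to the orthonormal basis
`√2 sin (λ_k s)` of `L²(0, 1)`, which consists of the eigenfunctions of the covariance kernel
`min s t` for the eigenvalues `1 / λ_k²`. -/
def klCoeff {n : ℕ} (W : ℝ≥0 → Ω → EuclideanSpace ℝ (Fin n)) (k : ℕ) (ω : Ω) :
    EuclideanSpace ℝ (Fin n) :=
  freq k • ∫ s in (0 : ℝ)..1, (√2 * Real.sin (freq k * s)) • W s.toNNReal ω

/-- The `m`-term truncation `X_t^m = e^{tL} X_0 + √2 ∑_{k=1}^m φ_{k,t}^{cos}(L) B Z_k` of the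
series representation of the solution of `dX = L X dt + B dW`. -/
def truncation {n : ℕ} (L B : Matrix (Fin n) (Fin n) ℝ)
    (W X : ℝ≥0 → Ω → EuclideanSpace ℝ (Fin n)) (m : ℕ) (t : ℝ≥0) (ω : Ω) :
    EuclideanSpace ℝ (Fin n) :=
  act (NormedSpace.exp ((t : ℝ) • L)) (X 0 ω)
    + √2 • ∑ k ∈ Finset.Icc 1 m, act (phiCos k t L * B) (klCoeff W k ω)

end SDEKarhunenLoeve

end

/-!
The solution is `X_t = e^{tL} X_0 + ∫_0^t e^{(t-s)L} B dW_s`, and `φ_{k,t}^{cos}(L)` is the integral of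
`e^{(t-s)L}` against `cos (λ_k s)` over `[0, t]` (`integral_cos_mul_exp_entry`). The truncation error
is thus the Wiener integral of the remainder, after `m` terms, of the expansion of the kernel
`s ↦ 1_{s ≤ t} e^{(t-s)L} B` in the orthonormal basis `√2 cos (λ_k s)` of `L²(0, 1)`. The Itô isometry
and Parseval's identity give the series for the mean square error.

No stochastic integral is needed. Variation of constants with an integration by parts
(`eq_variation_of_constants`) turns the error into a sum of integrals `∫ f_{ij}(s) W^j_s dμ(s)`, where
`μ` is Lebesgue measure on `(0, 1]` plus a unit mass at `t`. By Fubini, the second moment of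
`∫ f(s) W_s dμ(s)` depends only on the covariance function `min s u`, which is also that of the family
`v ↦ 1_{v ≤ s}` on the probability space `(0, 1]`; hence it equals `∫_0^1 (∫_{s ≥ v} f dμ)² dv`
(`integral_sq_integral_of_covariance`), and the inner integral is the remainder of the cosine
expansion of the kernel (`integral_errorWeight_tail`). Parseval's identity (`hasSum_sq_cosCoeff`) is
the one for Fourier series on a circle of length `2`, applied to `exp (-i π x / 2) f |x|`.

For the explicit bound, diagonalizing `L` reduces the claim to
`∑_{k > m} φ_{k,t}^{cos}(-a)² ≤ 1 / (π² (m - 1))` for `a ≥ 0`, `t ≥ 0` (`sum_sq_scalarPhi_le`).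
Here `|φ_{k,t}^{cos}(-a)|` can exceed `1 / λ_k`, so a termwise comparison does not suffice. If
`t ≥ 1 / 2`, the excess is small enough to be absorbed in the difference between `1 / m` and
`1 / (m - 1)`. If `t < 1 / 2` and `λ_{m+1} t ≥ π`, Abel summation shows that the squares of
the trigonometric terms average to about half of `1 / λ_k²`, which leaves room for the exponential
term. The remaining values of `m` follow by downward induction, as the bound `1 / λ_k` does hold while
`λ_k t ≤ π`.
-/

open MeasureTheory ProbabilityTheory Filter
open scoped NNReal

namespace SDEKarhunenLoeve

/-! ### Scalar estimates for a single frequency -/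

/-- The scalar function `φ_{k,t}^{cos}`. -/
noncomputable def scalarPhi (k : ℕ) (t z : ℝ) : ℝ :=
  (z * Real.exp (t * z) - Real.cos (freq k * t) * z + freq k * Real.sin (freq k * t))
    / (z ^ 2 + freq k ^ 2)

lemma freq_pos {k : ℕ} (hk : 1 ≤ k) : 0 < freq k := by
  have : (1 : ℝ) ≤ k := by exact_mod_cast hk
  exact mul_pos (by linarith) Real.pi_pos

lemma freq_succ (k : ℕ) : freq (k + 1) = freq k + Real.pi := by
  simp only [freq]; push_cast; ring

lemma scalarPhi_zero_time (k : ℕ) (z : ℝ) : scalarPhi k 0 z = 0 := by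
  simp [scalarPhi]

lemma scalarPhi_neg (k : ℕ) (t a : ℝ) :
    scalarPhi k t (-a) = (a * Real.cos (freq k * t) + freq k * Real.sin (freq k * t)
      - a * Real.exp (-(a * t))) / (a ^ 2 + freq k ^ 2) := by
  simp only [scalarPhi]
  rw [show t * -a = -(a * t) by ring]
  congr 1 <;> ring

/-- The maximum of `x e^{-x}` is `1 / e`. -/
lemma mul_exp_neg_le {a t : ℝ} (ht : 0 < t) : a * Real.exp (-(a * t)) ≤ Real.exp (-1) / t := by
  rw [le_div_iff₀ ht]
  have h := Real.add_one_le_exp (a * t - 1)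
  have h2 : Real.exp (-1) = Real.exp (a * t - 1) * Real.exp (-(a * t)) := by
    rw [← Real.exp_add]; ring_nf
  rw [h2]
  nlinarith [Real.exp_pos (-(a * t))]

lemma abs_trig_le (a l x : ℝ) :
    |a * Real.cos x + l * Real.sin x| ≤ √(a ^ 2 + l ^ 2) := by
  apply Real.abs_le_sqrt
  nlinarith [sq_nonneg (a * Real.sin x - l * Real.cos x), Real.sin_sq_add_cos_sq x]

/-- While `λ_k t ≤ π` the function `φ_{k,t}^{cos}` is bounded by `1 / λ_k` on `(-∞, 0]`. -/
lemma sq_scalarPhi_le_of_le_pi {k : ℕ} (hk : 1 ≤ k) {t a : ℝ} (ht : 0 ≤ t) (ha : 0 ≤ a)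
    (h : freq k * t ≤ Real.pi) : scalarPhi k t (-a) ^ 2 ≤ 1 / freq k ^ 2 := by
  have hl := freq_pos hk
  rw [scalarPhi_neg]
  set l := freq k
  have hs : 0 ≤ Real.sin (l * t) := Real.sin_nonneg_of_nonneg_of_le_pi (by positivity) h
  have hE0 := Real.exp_pos (-(a * t))
  have hE1 : Real.exp (-(a * t)) ≤ 1 := Real.exp_le_one_iff.2 (by nlinarith)
  have hc := Real.cos_le_one (l * t)
  have hc' := Real.neg_one_le_cos (l * t)
  have h1 := (abs_le.1 (abs_trig_le a l (l * t))).2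
  have h2 : √(a ^ 2 + l ^ 2) ≤ (a ^ 2 + l ^ 2) / l := by
    rw [Real.sqrt_le_left (by positivity), div_pow, le_div_iff₀ (by positivity)]
    nlinarith [sq_nonneg a, mul_nonneg (sq_nonneg a) (add_nonneg (sq_nonneg a) (sq_nonneg l))]
  rw [one_div, ← inv_pow, ← sq_abs]
  refine pow_le_pow_left₀ (abs_nonneg _) ?_ 2
  rw [abs_div, abs_of_pos (show 0 < a ^ 2 + l ^ 2 by positivity), div_le_iff₀ (by positivity),
    ← div_eq_inv_mul]
  rw [abs_le]
  constructor
  · have h3 : 2 * a ≤ (a ^ 2 + l ^ 2) / l := by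
      rw [le_div_iff₀ hl]; nlinarith [sq_nonneg (a - l)]
    nlinarith [mul_nonneg hl.le hs]
  · nlinarith [mul_nonneg ha hE0.le]

/-- The bound `1 / λ_k²` holds up to the cross term with the exponential; the square of the
exponential term is absorbed by replacing `a² + λ_k²` with `λ_k²`. -/
lemma sq_scalarPhi_le {k : ℕ} (hk : 1 ≤ k) {t a : ℝ} (ht : 0 ≤ t) (ha : 0 ≤ a) :
    scalarPhi k t (-a) ^ 2 ≤
      1 / freq k ^ 2 + 2 * (a * Real.exp (-(a * t))) / freq k ^ 3 := by
  have hl := freq_pos hk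
  rw [scalarPhi_neg]
  set l := freq k
  have hE0 := Real.exp_pos (-(a * t))
  have hE1 : Real.exp (-(a * t)) ≤ 1 := Real.exp_le_one_iff.2 (by nlinarith)
  set u := a * Real.cos (l * t) + l * Real.sin (l * t)
  set b := a * Real.exp (-(a * t)) with hb
  have hb0 : 0 ≤ b := by positivity
  have hba : b ≤ a := by nlinarith
  have hu := abs_trig_le a l (l * t)
  set R := √(a ^ 2 + l ^ 2) with hR
  have hR2 : R ^ 2 = a ^ 2 + l ^ 2 := Real.sq_sqrt (by positivity)
  have hRl : l ≤ R := Real.le_sqrt_of_sq_le (by nlinarith [sq_nonneg a])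
  have hR0 : 0 < R := hl.trans_le hRl
  obtain ⟨hu1, hu2⟩ := abs_le.1 hu
  have h1 : (u - b) ^ 2 ≤ (R + b) ^ 2 := by
    apply sq_le_sq'
    · linarith
    · linarith
  rw [← hR2, div_pow]
  have h2 : (R + b) ^ 2 / (R ^ 2) ^ 2 = 1 / R ^ 2 + 2 * b / R ^ 3 + b ^ 2 / R ^ 4 := by
    field_simp
    ring
  have h3 : 2 * b / R ^ 3 ≤ 2 * b / l ^ 3 := by gcongr
  have h4 : 1 / R ^ 2 + b ^ 2 / R ^ 4 ≤ 1 / l ^ 2 := by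
    have : 1 / l ^ 2 - (1 / R ^ 2 + a ^ 2 / R ^ 4) = a ^ 4 / (l ^ 2 * R ^ 4) := by
      field_simp
      have : R ^ 4 = (a ^ 2 + l ^ 2) ^ 2 := by rw [← hR2]; ring
      rw [this, hR2]; ring
    have h5 : b ^ 2 / R ^ 4 ≤ a ^ 2 / R ^ 4 := by gcongr
    have h6 : 0 ≤ a ^ 4 / (l ^ 2 * R ^ 4) := by positivity
    linarith
  calc (u - b) ^ 2 / (R ^ 2) ^ 2 ≤ (R + b) ^ 2 / (R ^ 2) ^ 2 := by gcongr
    _ ≤ _ := by rw [h2]; linarith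

lemma sum_le_of_le_telescoping {c : ℕ → ℝ} {m : ℕ} (hm : 2 ≤ m)
    (hc : ∀ k, m < k → c k ≤ 1 / Real.pi ^ 2 * (1 / ((k : ℝ) - 2) - 1 / ((k : ℝ) - 1))) (N : ℕ) :
    ∑ j ∈ Finset.range N, c (m + 1 + j) ≤
      1 / Real.pi ^ 2 * (1 / ((m : ℝ) - 1)) := by
  have hm' : (2 : ℝ) ≤ m := by exact_mod_cast hm
  have key : ∑ j ∈ Finset.range N, c (m + 1 + j) ≤
      1 / Real.pi ^ 2 * (1 / ((m : ℝ) - 1) - 1 / ((m : ℝ) + N - 1)) := by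
    induction N with
    | zero => simp
    | succ N ih =>
      rw [Finset.sum_range_succ]
      have h := hc (m + 1 + N) (by omega)
      push_cast at h ⊢
      rw [show (m : ℝ) + 1 + N - 2 = m + N - 1 by ring,
        show (m : ℝ) + 1 + N - 1 = m + (N + 1) - 1 by ring] at h
      rw [mul_sub] at h ih ⊢
      linarith
  refine key.trans (mul_le_mul_of_nonneg_left ?_ (by positivity))
  have : 0 ≤ 1 / ((m : ℝ) + N - 1) := by
    have : (0 : ℝ) ≤ N := N.cast_nonneg
    apply one_div_nonneg.2; linarith
  linarith

lemma one_div_freq_sq_le {k : ℕ} (hk : 3 ≤ k) :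
    1 / freq k ^ 2 ≤ 1 / Real.pi ^ 2 * (1 / ((k : ℝ) - 2) - 1 / ((k : ℝ) - 1)) := by
  have hk' : (3 : ℝ) ≤ k := by exact_mod_cast hk
  have h1 : (0 : ℝ) < k - 2 := by linarith
  have h2 : (0 : ℝ) < k - 1 := by linarith
  have h3 : (0 : ℝ) < k - 1 / 2 := by linarith
  rw [freq, mul_pow, mul_comm, one_div, mul_inv, ← one_div]
  refine mul_le_mul_of_nonneg_left ?_ (by positivity)
  rw [div_sub_div _ _ h1.ne' h2.ne', inv_eq_one_div, div_le_div_iff₀ (by positivity) (by positivity)]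
  nlinarith

/-- For `t ≥ 1 / 2` the exponential term of `φ_{k,t}^{cos}` is so small that the tail can be
estimated term by term. -/
lemma sq_scalarPhi_le_of_half_le {k : ℕ} (hk : 3 ≤ k) {t a : ℝ} (ht : 1 / 2 ≤ t) (ha : 0 ≤ a) :
    scalarPhi k t (-a) ^ 2 ≤
      1 / Real.pi ^ 2 * (1 / ((k : ℝ) - 2) - 1 / ((k : ℝ) - 1)) := by
  have hk' : (3 : ℝ) ≤ k := by exact_mod_cast hk
  have h1 : (0 : ℝ) < k - 2 := by linarith
  have h2 : (0 : ℝ) < k - 1 := by linarith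
  have hx : (0 : ℝ) < k - 1 / 2 := by linarith
  have hpi := Real.pi_gt_three
  have hl := freq_pos (show 1 ≤ k by omega)
  have hb : a * Real.exp (-(a * t)) ≤ Real.pi := by
    refine (mul_exp_neg_le (by linarith)).trans ?_
    rw [div_le_iff₀ (by linarith)]
    have : Real.exp (-1) ≤ 1 := Real.exp_le_one_iff.2 (by norm_num)
    nlinarith
  refine (sq_scalarPhi_le (by omega) (by linarith) ha).trans ?_
  calc 1 / freq k ^ 2 + 2 * (a * Real.exp (-(a * t))) / freq k ^ 3
      ≤ 1 / freq k ^ 2 + 2 * Real.pi / freq k ^ 3 := by gcongr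
    _ = 1 / Real.pi ^ 2 * ((k - 1 / 2 + 2) / ((k : ℝ) - 1 / 2) ^ 3) := by
      rw [freq]; field_simp
    _ ≤ _ := by
      refine mul_le_mul_of_nonneg_left ?_ (by positivity)
      rw [div_sub_div _ _ h1.ne' h2.ne', div_le_div_iff₀ (by positivity) (by positivity)]
      nlinarith

/-! ### The tail of the scalar series -/

/-- Abel summation, for weights `w j` whose variation is dominated by that of a decreasing
sequence `b j`. -/
lemma norm_sum_mul_le_of_variation {E w : ℕ → ℂ} {b : ℕ → ℝ} (hE : ∀ j, ‖E j‖ ≤ 1)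
    (hw : ∀ j, ‖w j‖ ≤ b j) (hwb : ∀ j, ‖w j - w (j + 1)‖ ≤ b j - b (j + 1)) (N : ℕ) :
    ‖∑ j ∈ Finset.range N, (E (j + 1) - E j) * w j‖ ≤ 2 * b 0 := by
  have key : ‖(∑ j ∈ Finset.range N, (E (j + 1) - E j) * w j) - E N * w N‖ ≤ 2 * b 0 - b N := by
    induction N with
    | zero =>
      have h0 := norm_mul_le (E 0) (w 0)
      have := mul_le_mul (hE 0) (hw 0) (norm_nonneg _) zero_le_one
      simp only [Finset.range_zero, Finset.sum_empty, zero_sub, norm_neg]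
      linarith
    | succ N ih =>
      have h1 : (∑ j ∈ Finset.range (N + 1), (E (j + 1) - E j) * w j) - E (N + 1) * w (N + 1) =
          ((∑ j ∈ Finset.range N, (E (j + 1) - E j) * w j) - E N * w N)
            + E (N + 1) * (w N - w (N + 1)) := by
        rw [Finset.sum_range_succ]; ring
      have h2 : ‖E (N + 1) * (w N - w (N + 1))‖ ≤ 1 * (b N - b (N + 1)) := by
        rw [norm_mul]
        exact mul_le_mul (hE _) (hwb N) (norm_nonneg _) zero_le_one
      rw [h1]
      refine (norm_add_le _ _).trans ?_
      linarith
  have h1 : ‖E N * w N‖ ≤ 1 * b N := by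
    rw [norm_mul]
    exact mul_le_mul (hE _) (hw N) (norm_nonneg _) zero_le_one
  calc _ = ‖((∑ j ∈ Finset.range N, (E (j + 1) - E j) * w j) - E N * w N) + E N * w N‖ := by
        rw [sub_add_cancel]
    _ ≤ _ := norm_add_le _ _
    _ ≤ _ := by linarith

lemma norm_inv_sq_sub_le {a l l' : ℝ} (hl : 0 < l) (h : l ≤ l') :
    ‖((a + l * Complex.I) ^ 2)⁻¹ - (((a : ℂ) + l' * Complex.I) ^ 2)⁻¹‖ ≤ 1 / l ^ 2 - 1 / l' ^ 2 := by
  have hl' : 0 < l' := hl.trans_le h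
  set z : ℂ := a + l * Complex.I
  set z' : ℂ := a + l' * Complex.I
  have hz : l ≤ ‖z‖ := by
    have := Complex.abs_im_le_norm z
    simpa [z, abs_of_pos hl] using this
  have hz' : l' ≤ ‖z'‖ := by
    have := Complex.abs_im_le_norm z'
    simpa [z', abs_of_pos hl'] using this
  have hz0 : z ≠ 0 := norm_pos_iff.1 (hl.trans_le hz)
  have hz0' : z' ≠ 0 := norm_pos_iff.1 (hl'.trans_le hz')
  have h1 : (z ^ 2)⁻¹ - (z' ^ 2)⁻¹ = (z' - z) * (z⁻¹ * z'⁻¹) * (z⁻¹ + z'⁻¹) := by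
    field_simp; ring
  have h2 : ‖z' - z‖ = l' - l := by
    rw [show z' - z = ((l' - l : ℝ) : ℂ) * Complex.I by simp only [z, z']; push_cast; ring]
    rw [norm_mul, Complex.norm_I, mul_one, Complex.norm_real, Real.norm_of_nonneg (by linarith)]
  have h3 : ‖z⁻¹‖ ≤ l⁻¹ := by rw [norm_inv]; exact inv_anti₀ hl hz
  have h4 : ‖z'⁻¹‖ ≤ l'⁻¹ := by rw [norm_inv]; exact inv_anti₀ hl' hz'
  rw [h1, norm_mul, norm_mul, norm_mul, h2]
  calc (l' - l) * (‖z⁻¹‖ * ‖z'⁻¹‖) * ‖z⁻¹ + z'⁻¹‖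
      ≤ (l' - l) * (l⁻¹ * l'⁻¹) * (l⁻¹ + l'⁻¹) := by
        have := (norm_add_le z⁻¹ z'⁻¹).trans (add_le_add h3 h4)
        have h5 : 0 ≤ l' - l := by linarith
        gcongr
    _ = _ := by field_simp; ring

/-- The oscillating part of the tail `∑_{k > m} (a cos (λ_k t) + λ_k sin (λ_k t))² / (a² + λ_k²)²`,
estimated by Abel summation. -/
lemma norm_sum_exp_mul_inv_sq_le {t : ℝ} (hs : 0 < Real.sin (Real.pi * t)) (a : ℝ) (m N : ℕ) :
    ‖∑ j ∈ Finset.range N, Complex.exp ((2 * freq (m + 1 + j) * t : ℝ) * Complex.I) *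
      (((a : ℂ) + freq (m + 1 + j) * Complex.I) ^ 2)⁻¹‖ ≤
      1 / (freq (m + 1) ^ 2 * Real.sin (Real.pi * t)) := by
  have hA := norm_sum_mul_le_of_variation
    (E := fun j => Complex.exp ((2 * Real.pi * ((m + j : ℕ) : ℝ) * t : ℝ) * Complex.I))
    (w := fun j => (((a : ℂ) + freq (m + 1 + j) * Complex.I) ^ 2)⁻¹)
    (b := fun j => 1 / freq (m + 1 + j) ^ 2) (fun j => (Complex.norm_exp_ofReal_mul_I _).le)
    (fun j => by
      have hl := freq_pos (show 1 ≤ m + 1 + j by omega)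
      have hz : freq (m + 1 + j) ≤ ‖(a : ℂ) + freq (m + 1 + j) * Complex.I‖ := by
        have := Complex.abs_im_le_norm ((a : ℂ) + freq (m + 1 + j) * Complex.I)
        simpa [abs_of_pos hl] using this
      rw [norm_inv, norm_pow, one_div]
      gcongr)
    (fun j => by
      have hl := freq_pos (show 1 ≤ m + 1 + j by omega)
      have := freq_succ (m + 1 + j)
      exact norm_inv_sq_sub_le hl (by rw [← add_assoc, this]; linarith [Real.pi_pos])) N
  have hE (j : ℕ) : Complex.exp ((2 * Real.pi * ((m + (j + 1) : ℕ) : ℝ) * t : ℝ) * Complex.I)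
      - Complex.exp ((2 * Real.pi * ((m + j : ℕ) : ℝ) * t : ℝ) * Complex.I) =
      (2 * Real.sin (Real.pi * t) * Complex.I) *
        Complex.exp ((2 * freq (m + 1 + j) * t : ℝ) * Complex.I) := by
    have h1 : ((2 * Real.pi * ((m + (j + 1) : ℕ) : ℝ) * t : ℝ) : ℂ) * Complex.I =
        (2 * freq (m + 1 + j) * t : ℝ) * Complex.I + (Real.pi * t : ℝ) * Complex.I := by
      simp only [freq]; push_cast; ring
    have h2 : ((2 * Real.pi * ((m + j : ℕ) : ℝ) * t : ℝ) : ℂ) * Complex.I =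
        (2 * freq (m + 1 + j) * t : ℝ) * Complex.I + (-(Real.pi * t) : ℝ) * Complex.I := by
      simp only [freq]; push_cast; ring
    rw [h1, h2, Complex.exp_add, Complex.exp_add, Complex.exp_mul_I ((Real.pi * t : ℝ) : ℂ),
      Complex.exp_mul_I ((-(Real.pi * t) : ℝ) : ℂ)]
    push_cast
    rw [Complex.cos_neg, Complex.sin_neg]
    ring
  simp only [hE, mul_assoc _ (Complex.exp _), ← Finset.mul_sum] at hA
  rw [norm_mul, norm_mul, norm_mul, Complex.norm_I, mul_one, Complex.norm_real,
    Real.norm_of_nonneg hs.le] at hA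
  rw [le_div_iff₀ (mul_pos (pow_pos (freq_pos (by omega)) 2) hs)]
  have hl := freq_pos (show 1 ≤ m + 1 by omega)
  simp only [add_zero, mul_one_div] at hA
  rw [le_div_iff₀ (by positivity)] at hA
  rw [show ‖(2 : ℂ)‖ = 2 by norm_num] at hA
  linarith

/-- The identity `(Re w)² = |w|² / 2 + Re (w²) / 2` for `w = e^{iλt} / (a + iλ)`. -/
lemma trig_sq_eq (a l t : ℝ) (hl : 0 < l) :
    ((a * Real.cos (l * t) + l * Real.sin (l * t)) / (a ^ 2 + l ^ 2)) ^ 2 =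
      1 / 2 * (1 / (a ^ 2 + l ^ 2)) + 1 / 2 *
        (Complex.exp ((2 * l * t : ℝ) * Complex.I) * (((a : ℂ) + l * Complex.I) ^ 2)⁻¹).re := by
  have hR : 0 < a ^ 2 + l ^ 2 := by positivity
  have h1 : ((a : ℂ) + l * Complex.I)⁻¹ = (a - l * Complex.I) / ((a ^ 2 + l ^ 2 : ℝ) : ℂ) := by
    have hne : (a : ℂ) + l * Complex.I ≠ 0 := by
      intro h
      have := congrArg Complex.im h
      simp at this
      exact hl.ne' this
    have hne' : ((a ^ 2 + l ^ 2 : ℝ) : ℂ) ≠ 0 := by exact_mod_cast hR.ne'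
    rw [inv_eq_one_div, div_eq_div_iff hne hne']
    push_cast
    linear_combination (l : ℂ) ^ 2 * Complex.I_sq
  have h2 : Complex.exp ((2 * l * t : ℝ) * Complex.I) * (((a : ℂ) + l * Complex.I) ^ 2)⁻¹ =
      (Complex.exp ((l * t : ℝ) * Complex.I) * ((a : ℂ) + l * Complex.I)⁻¹) ^ 2 := by
    rw [mul_pow, ← Complex.exp_nat_mul, inv_pow]
    congr 2
    push_cast; ring
  have h3 : Complex.exp ((l * t : ℝ) * Complex.I) * ((a : ℂ) + l * Complex.I)⁻¹ =
      ((a * Real.cos (l * t) + l * Real.sin (l * t)) / (a ^ 2 + l ^ 2) : ℝ) +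
      ((a * Real.sin (l * t) - l * Real.cos (l * t)) / (a ^ 2 + l ^ 2) : ℝ) * Complex.I := by
    rw [h1, Complex.exp_mul_I, ← Complex.ofReal_cos, ← Complex.ofReal_sin]
    have hne' : ((a : ℂ) ^ 2 + l ^ 2 ) ≠ 0 := by exact_mod_cast hR.ne'
    push_cast
    field_simp
    linear_combination (-l * Complex.sin (l * t) : ℂ) * Complex.I_sq
  rw [h2, h3]
  simp only [pow_two (_ + _ * Complex.I), Complex.mul_re, Complex.add_re, Complex.add_im,
    Complex.ofReal_re, Complex.ofReal_im, Complex.I_re, Complex.I_im, Complex.mul_im]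
  have hcs := Real.sin_sq_add_cos_sq (l * t)
  generalize Real.sin (l * t) = s at *
  generalize Real.cos (l * t) = c at *
  field_simp
  ring_nf
  have : s ^ 2 = 1 - c ^ 2 := by linarith
  simp only [this]
  ring

lemma sum_one_div_freq_sq_le (m N : ℕ) (hm : 1 ≤ m) :
    ∑ j ∈ Finset.range N, 1 / freq (m + 1 + j) ^ 2 ≤ 1 / (Real.pi ^ 2 * m) := by
  have hm' : (1 : ℝ) ≤ m := by exact_mod_cast hm
  have key : ∑ j ∈ Finset.range N, 1 / freq (m + 1 + j) ^ 2 ≤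
      1 / Real.pi ^ 2 * (1 / (m : ℝ) - 1 / ((m : ℝ) + N)) := by
    induction N with
    | zero => simp
    | succ N ih =>
      have hN : (0 : ℝ) ≤ N := N.cast_nonneg
      have h : 1 / freq (m + 1 + N) ^ 2 ≤
          1 / Real.pi ^ 2 * (1 / ((m : ℝ) + N) - 1 / ((m : ℝ) + (N + 1))) := by
        rw [freq, mul_pow, mul_comm, one_div, mul_inv, ← one_div]
        refine mul_le_mul_of_nonneg_left ?_ (by positivity)
        push_cast
        have h3 : (0 : ℝ) < m + 1 + N - 1 / 2 := by linarith
        rw [div_sub_div _ _ (by positivity) (by positivity), inv_eq_one_div,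
          div_le_div_iff₀ (by positivity) (by positivity)]
        nlinarith
      rw [Finset.sum_range_succ]
      push_cast
      rw [mul_sub] at h ih ⊢
      linarith
  refine key.trans ?_
  rw [← one_div_mul_one_div]
  refine mul_le_mul_of_nonneg_left ?_ (by positivity)
  have : 0 ≤ 1 / ((m : ℝ) + N) := by positivity
  linarith

/-- Once `λ_{m+1} t ≥ π`, the oscillation of `φ_{k,t}^{cos}` in `k` gains almost a factor two over
the termwise bound `1 / λ_k²`; this pays for the exponential term. -/
lemma sum_sq_scalarPhi_le_of_pi_le {m : ℕ} (hm : 2 ≤ m) {t a : ℝ} (ht : 0 < t) (ht2 : t ≤ 1 / 2)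
    (ha : 0 ≤ a) (h : Real.pi ≤ freq (m + 1) * t) (N : ℕ) :
    ∑ j ∈ Finset.range N, scalarPhi (m + 1 + j) t (-a) ^ 2 ≤
      1 / Real.pi ^ 2 * (1 / ((m : ℝ) - 1)) := by
  have hm' : (2 : ℝ) ≤ m := by exact_mod_cast hm
  have hpi := Real.pi_gt_three
  have hl := freq_pos (show 1 ≤ m + 1 by omega)
  have hsin : 2 * t ≤ Real.sin (Real.pi * t) := by
    have := Real.mul_le_sin (x := Real.pi * t) (by positivity) (by nlinarith)
    calc 2 * t = 2 / Real.pi * (Real.pi * t) := by field_simp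
      _ ≤ _ := this
  set b := a * Real.exp (-(a * t)) with hb
  have hb0 : 0 ≤ b := by positivity
  -- `(u - v)² ≤ 1.2 u² + 6 v²` separates the oscillating and the exponential part.
  have hterm (j : ℕ) : scalarPhi (m + 1 + j) t (-a) ^ 2 ≤
      (0.6 + 6 * b ^ 2 / freq (m + 1) ^ 2) * (1 / freq (m + 1 + j) ^ 2) + 0.6 *
        (Complex.exp ((2 * freq (m + 1 + j) * t : ℝ) * Complex.I) *
          (((a : ℂ) + freq (m + 1 + j) * Complex.I) ^ 2)⁻¹).re := by
    have hl' := freq_pos (show 1 ≤ m + 1 + j by omega)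
    have hmono : freq (m + 1) ≤ freq (m + 1 + j) := by
      simp only [freq]; push_cast
      have : (0 : ℝ) ≤ j := j.cast_nonneg
      exact mul_le_mul_of_nonneg_right (by linarith) Real.pi_pos.le
    have h1 := trig_sq_eq a (freq (m + 1 + j)) t hl'
    rw [scalarPhi_neg]
    set l := freq (m + 1 + j)
    set R := a ^ 2 + l ^ 2
    have hR : l ^ 2 ≤ R := by nlinarith [sq_nonneg a]
    have hR0 : 0 < R := by positivity
    rw [sub_div]
    set u := (a * Real.cos (l * t) + l * Real.sin (l * t)) / R
    have h2 : 1 / R ≤ 1 / l ^ 2 := by gcongr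
    have h3 : (b / R) ^ 2 ≤ b ^ 2 / freq (m + 1) ^ 2 * (1 / l ^ 2) := by
      rw [div_pow, div_mul_div_comm, mul_one, pow_two R]
      gcongr
      exact (pow_le_pow_left₀ hl.le hmono 2).trans hR
    have h4 : (u - b / R) ^ 2 ≤ 1.2 * u ^ 2 + 6 * (b / R) ^ 2 := by
      nlinarith [sq_nonneg (u + 5 * (b / R))]
    have h5 : 6 * (b / R) ^ 2 ≤ 6 * b ^ 2 / freq (m + 1) ^ 2 * (1 / l ^ 2) := by
      calc _ ≤ 6 * (b ^ 2 / freq (m + 1) ^ 2 * (1 / l ^ 2)) := by gcongr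
        _ = _ := by ring
    rw [h1] at h4
    linarith
  have hosc := (Complex.re_le_norm _).trans
    (norm_sum_exp_mul_inv_sq_le (t := t) (by linarith) a m N)
  rw [Complex.re_sum] at hosc
  -- `b t ≤ 1 / e ≤ 3 / 8` and `λ_{m+1} t ≥ π` make the exponential term negligible.
  have hb2 : b ^ 2 / freq (m + 1) ^ 2 ≤ 1 / 60 := by
    have h1 : b * t ≤ Real.exp (-1) := by
      have := mul_exp_neg_le (a := a) ht
      rwa [le_div_iff₀ ht] at this
    have h2 : Real.exp (-1) ≤ 3 / 8 := by
      rw [Real.exp_neg, inv_le_comm₀ (Real.exp_pos _) (by norm_num)]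
      linarith [Real.exp_one_gt_d9]
    have h3 : b * 8 ≤ freq (m + 1) := by
      have : b * 8 * t ≤ freq (m + 1) * t := by nlinarith
      exact le_of_mul_le_mul_right this ht
    rw [div_le_iff₀ (by positivity)]
    nlinarith
  have hosc2 : 1 / (freq (m + 1) ^ 2 * Real.sin (Real.pi * t)) ≤ 1 / (2 * (Real.pi ^ 2 * m)) := by
    have h1 : freq (m + 1) * (2 * Real.pi) ≤ freq (m + 1) ^ 2 * Real.sin (Real.pi * t) := by
      calc freq (m + 1) * (2 * Real.pi) ≤ freq (m + 1) * (2 * (freq (m + 1) * t)) := by gcongr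
        _ = freq (m + 1) ^ 2 * (2 * t) := by ring
        _ ≤ _ := by gcongr
    apply one_div_le_one_div_of_le (by positivity)
    refine le_trans ?_ h1
    simp only [freq]; push_cast
    nlinarith [Real.pi_pos]
  have hmain := sum_one_div_freq_sq_le m N (by omega)
  calc _ ≤ _ := Finset.sum_le_sum fun j _ => hterm j
    _ = (0.6 + 6 * b ^ 2 / freq (m + 1) ^ 2) * ∑ j ∈ Finset.range N, 1 / freq (m + 1 + j) ^ 2
        + 0.6 * ∑ j ∈ Finset.range N, (Complex.exp ((2 * freq (m + 1 + j) * t : ℝ) * Complex.I) *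
          (((a : ℂ) + freq (m + 1 + j) * Complex.I) ^ 2)⁻¹).re := by
      rw [Finset.sum_add_distrib, Finset.mul_sum, Finset.mul_sum]
    _ ≤ (0.6 + 6 * (1 / 60)) * (1 / (Real.pi ^ 2 * m)) + 0.6 * (1 / (2 * (Real.pi ^ 2 * m))) := by
      have h1 : 6 * b ^ 2 / freq (m + 1) ^ 2 ≤ 6 * (1 / 60) := by
        rw [mul_div_assoc]; gcongr
      have := hosc.trans hosc2
      gcongr
    _ = 1 / (Real.pi ^ 2 * m) := by field_simp; norm_num
    _ ≤ _ := by
      rw [← one_div_mul_one_div]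
      gcongr
      · linarith
      · linarith

/-- The tail bound for the scalar functions, uniformly in `a ≥ 0` and `t ≥ 0`. -/
theorem sum_sq_scalarPhi_le {m : ℕ} (hm : 2 ≤ m) {t a : ℝ} (ht : 0 ≤ t)
    (ha : 0 ≤ a) (N : ℕ) :
    ∑ j ∈ Finset.range N, scalarPhi (m + 1 + j) t (-a) ^ 2 ≤
      1 / Real.pi ^ 2 * (1 / ((m : ℝ) - 1)) := by
  rcases le_or_gt (1 / 2) t with ht2 | ht2
  · exact sum_le_of_le_telescoping hm (fun k hk => sq_scalarPhi_le_of_half_le (by omega) ht2 ha) N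
  rcases ht.eq_or_lt with rfl | ht0
  · have hm' : (2 : ℝ) ≤ m := by exact_mod_cast hm
    simp only [scalarPhi_zero_time]
    have : (0 : ℝ) ≤ 1 / Real.pi ^ 2 * (1 / ((m : ℝ) - 1)) :=
      mul_nonneg (by positivity) (one_div_nonneg.2 (by linarith))
    simpa using this
  -- Downward induction on `m`, starting where `λ_{m+1} t ≥ π`.
  obtain ⟨d, hd⟩ : ∃ d : ℕ, Real.pi ≤ freq (m + d + 1) * t := by
    obtain ⟨d, hd⟩ := exists_nat_ge (1 / t)
    refine ⟨d, ?_⟩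
    rw [div_le_iff₀ ht0] at hd
    have : (0 : ℝ) ≤ m := m.cast_nonneg
    simp only [freq]; push_cast
    nlinarith [Real.pi_pos, mul_nonneg this ht0.le, mul_pos Real.pi_pos ht0]
  induction d generalizing m N with
  | zero => exact sum_sq_scalarPhi_le_of_pi_le hm ht0 ht2.le ha hd N
  | succ d ih =>
    rcases le_or_gt Real.pi (freq (m + 1) * t) with h | h
    · exact sum_sq_scalarPhi_le_of_pi_le hm ht0 ht2.le ha h N
    have hm' : (2 : ℝ) ≤ m := by exact_mod_cast hm
    cases N with
    | zero =>
      have : (0 : ℝ) ≤ 1 / Real.pi ^ 2 * (1 / ((m : ℝ) - 1)) :=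
        mul_nonneg (by positivity) (one_div_nonneg.2 (by linarith))
      simpa using this
    | succ N =>
      have h1 := ih (m := m + 1) (by omega) N (by rwa [show m + 1 + d + 1 = m + (d + 1) + 1 by ring])
      have h2 := (sq_scalarPhi_le_of_le_pi (show 1 ≤ m + 1 by omega) ht ha h.le).trans
        (one_div_freq_sq_le (by omega))
      rw [Finset.sum_range_succ']
      have h3 (j : ℕ) : m + 1 + (j + 1) = m + 1 + 1 + j := by ring
      rw [Finset.sum_congr rfl fun j _ => by rw [h3 j], add_zero]
      push_cast at h1 h2
      rw [add_sub_cancel_right] at h1 h2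
      rw [show (m : ℝ) + 1 - 2 = m - 1 by ring, mul_sub] at h2
      linarith

/-! ### Parseval's identity for the half-integer cosines -/

lemma integrableOn_Icc_of_bounded {E : Type*} [NormedAddCommGroup E] {f : ℝ → E} {C a b : ℝ}
    (hf : StronglyMeasurable f) (hC : ∀ x ∈ Set.Icc a b, ‖f x‖ ≤ C) :
    IntegrableOn f (Set.Icc a b) := by
  refine Measure.integrableOn_of_bounded (M := C) (by simp) hf.aestronglyMeasurable ?_
  filter_upwards [ae_restrict_mem measurableSet_Icc] with x hx using hC x hx

lemma integral_neg_one_one_eq {g : ℝ → ℂ} {C : ℝ} (hg : StronglyMeasurable g)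
    (hC : ∀ x ∈ Set.Icc (-1 : ℝ) 1, ‖g x‖ ≤ C) :
    ∫ x in (-1 : ℝ)..1, g x = ∫ x in (0 : ℝ)..1, (g x + g (-x)) := by
  have h1 : IntervalIntegrable g volume (-1) 0 :=
    (intervalIntegrable_iff_integrableOn_Icc_of_le (by norm_num)).2
      (integrableOn_Icc_of_bounded hg fun x hx => hC x ⟨hx.1, by linarith [hx.2]⟩)
  have h2 : IntervalIntegrable g volume 0 1 :=
    (intervalIntegrable_iff_integrableOn_Icc_of_le (by norm_num)).2
      (integrableOn_Icc_of_bounded hg fun x hx => hC x ⟨by linarith [hx.1], hx.2⟩)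
  have h3 : IntervalIntegrable (fun x => g (-x)) volume 0 1 :=
    (intervalIntegrable_iff_integrableOn_Icc_of_le (by norm_num)).2
      (integrableOn_Icc_of_bounded (hg.comp_measurable measurable_neg)
        fun x hx => hC (-x) ⟨by linarith [hx.2], by linarith [hx.1]⟩)
  rw [intervalIntegral.integral_add h2 h3, intervalIntegral.integral_comp_neg, neg_zero,
    add_comm, intervalIntegral.integral_add_adjacent_intervals h1 h2]

/-- Parseval's identity for the orthonormal basis `√2 cos (λ_k s)`, `k ≥ 1`, of `L²(0, 1)`. -/
theorem hasSum_sq_cosCoeff {f : ℝ → ℝ} {C : ℝ} (hf : Measurable f)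
    (hC : ∀ x ∈ Set.Icc (0 : ℝ) 1, |f x| ≤ C) :
    HasSum (fun j : ℕ => 2 * (∫ s in (0 : ℝ)..1, f s * Real.cos (freq (j + 1) * s)) ^ 2)
      (∫ s in (0 : ℝ)..1, f s ^ 2) := by
  -- The coefficients are the Fourier coefficients of `exp (-i π x / 2) f |x|` on `(-1, 1]`.
  set G : ℝ → ℂ := fun x => Complex.exp ((-(Real.pi / 2 * x) : ℝ) * Complex.I) * (f |x| : ℝ) with hG
  have hnorm (x : ℝ) : ‖G x‖ = |f (|x|)| := by
    rw [hG, norm_mul, Complex.norm_exp_ofReal_mul_I, one_mul, Complex.norm_real, Real.norm_eq_abs]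
  have hGm : Measurable G := by
    have : Measurable fun x : ℝ => f |x| := hf.comp measurable_norm
    fun_prop
  have hGC (x : ℝ) (hx : x ∈ Set.Icc (-1 : ℝ) 1) : ‖G x‖ ≤ C := by
    rw [hnorm]
    exact hC _ ⟨abs_nonneg x, abs_le.2 hx⟩
  have hL2 : MemLp G 2 (volume.restrict (Set.Ioc (-1 : ℝ) 1)) := by
    refine MemLp.of_bound hGm.aestronglyMeasurable C ?_
    filter_upwards [ae_restrict_mem measurableSet_Ioc] with x hx
    exact hGC x (Set.Ioc_subset_Icc_self hx)
  have hmain := hasSum_sq_fourierCoeffOn (show (-1 : ℝ) < 1 by norm_num) hL2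
  have hcoef (n : ℤ) : fourierCoeffOn (show (-1 : ℝ) < 1 by norm_num) G n =
      ((∫ s in (0 : ℝ)..1, f s * Real.cos ((n + 1 / 2) * Real.pi * s) : ℝ) : ℂ) := by
    have hexp (x : ℝ) : fourier (-n) (x : AddCircle ((1 : ℝ) - -1)) • G x =
        Complex.exp ((-((n + 1 / 2) * Real.pi * x) : ℝ) * Complex.I) * (f |x| : ℝ) := by
      rw [fourier_coe_apply, smul_eq_mul, hG, ← mul_assoc, ← Complex.exp_add]
      congr 2
      push_cast
      ring
    rw [fourierCoeffOn_eq_integral]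
    simp only [hexp]
    rw [integral_neg_one_one_eq (C := C), ← intervalIntegral.integral_ofReal,
      ← intervalIntegral.integral_smul]
    · refine intervalIntegral.integral_congr fun x hx => ?_
      rw [Set.uIcc_of_le zero_le_one] at hx
      simp only [abs_neg, abs_of_nonneg hx.1]
      rw [← add_mul, Complex.real_smul]
      have hcos := Complex.two_cos (((n + 1 / 2) * Real.pi * x : ℝ) : ℂ)
      push_cast at hcos ⊢
      rw [show -(((n : ℂ) + 1 / 2) * Real.pi * -x) = (n + 1 / 2) * Real.pi * x by ring,
        add_comm, ← hcos]
      ring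
    · have : Measurable fun x : ℝ => f |x| := hf.comp measurable_norm
      exact Measurable.stronglyMeasurable (by fun_prop)
    · intro x hx
      rw [norm_mul, Complex.norm_exp_ofReal_mul_I, one_mul, Complex.norm_real,
        Real.norm_eq_abs, ← hnorm]
      exact hGC x hx
  have hint : ((1 : ℝ) - -1)⁻¹ • ∫ x in (-1 : ℝ)..1, ‖G x‖ ^ 2 = ∫ s in (0 : ℝ)..1, f s ^ 2 := by
    have := integral_neg_one_one_eq (g := fun x => ((f |x| ^ 2 : ℝ) : ℂ)) (C := C ^ 2)
      (by
        have : Measurable fun x : ℝ => f |x| := hf.comp measurable_norm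
        exact Measurable.stronglyMeasurable (by fun_prop))
      (fun x hx => by
        rw [Complex.norm_real, norm_pow, Real.norm_eq_abs, ← hnorm]
        exact pow_le_pow_left₀ (norm_nonneg _) (hGC x hx) 2)
    simp only [abs_neg, ← Complex.ofReal_add] at this
    rw [intervalIntegral.integral_ofReal, intervalIntegral.integral_ofReal] at this
    have h := Complex.ofReal_injective this
    simp only [hnorm, sq_abs]
    rw [h, ← intervalIntegral.integral_smul]
    refine intervalIntegral.integral_congr fun x hx => ?_
    rw [Set.uIcc_of_le zero_le_one] at hx
    simp only [abs_of_nonneg hx.1, smul_eq_mul]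
    ring
  rw [hint] at hmain
  refine hmain.nat_add_neg_add_one.congr_fun fun j => ?_
  simp only [hcoef, Complex.norm_real, Real.norm_eq_abs, sq_abs]
  have h1 : (((j : ℤ) : ℝ) + 1 / 2) * Real.pi = freq (j + 1) := by
    simp only [freq]; push_cast; ring
  have h2 : (((-((j : ℤ) + 1) : ℤ) : ℝ) + 1 / 2) * Real.pi = -freq (j + 1) := by
    simp only [freq]; push_cast; ring
  rw [h1, h2]
  simp only [neg_mul, Real.cos_neg]
  ring

lemma integral_cos_mul {a : ℝ} (ha : a ≠ 0) :
    ∫ s in (0 : ℝ)..1, Real.cos (a * s) = Real.sin a / a := by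
  rw [intervalIntegral.integral_comp_mul_left _ ha]
  simp [div_eq_inv_mul]

lemma sin_nat_sub_nat_mul_pi (k l : ℕ) : Real.sin (((k : ℝ) - l) * Real.pi) = 0 := by
  have := Real.sin_int_mul_pi ((k : ℤ) - l)
  push_cast at this
  exact this

lemma integral_cos_mul_cos {k l : ℕ} (hk : 1 ≤ k) (hl : 1 ≤ l) :
    ∫ s in (0 : ℝ)..1, Real.cos (freq k * s) * Real.cos (freq l * s) =
      if k = l then 1 / 2 else 0 := by
  have hk' : (1 : ℝ) ≤ k := by exact_mod_cast hk
  have hl' : (1 : ℝ) ≤ l := by exact_mod_cast hl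
  have h (s : ℝ) : Real.cos (freq k * s) * Real.cos (freq l * s) =
      1 / 2 * Real.cos (((k : ℝ) - l) * Real.pi * s)
        + 1 / 2 * Real.cos (((k : ℝ) + l - 1) * Real.pi * s) := by
    rw [show ((k : ℝ) - l) * Real.pi * s = freq k * s - freq l * s by simp only [freq]; ring,
      show ((k : ℝ) + l - 1) * Real.pi * s = freq k * s + freq l * s by simp only [freq]; ring,
      Real.cos_sub, Real.cos_add]
    ring
  have hplus : ∫ s in (0 : ℝ)..1, Real.cos (((k : ℝ) + l - 1) * Real.pi * s) = 0 := by
    rw [integral_cos_mul (mul_ne_zero (by linarith) Real.pi_ne_zero)]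
    have := sin_nat_sub_nat_mul_pi (k + l) 1
    push_cast at this
    rw [this, zero_div]
  simp only [h]
  rw [intervalIntegral.integral_add (Continuous.intervalIntegrable (by fun_prop) _ _)
      (Continuous.intervalIntegrable (by fun_prop) _ _), intervalIntegral.integral_const_mul,
    intervalIntegral.integral_const_mul, hplus]
  split_ifs with hkl
  · subst hkl; simp
  · have hne : (k : ℝ) - l ≠ 0 := sub_ne_zero.2 (by exact_mod_cast hkl)
    rw [integral_cos_mul (mul_ne_zero hne Real.pi_ne_zero), sin_nat_sub_nat_mul_pi]
    simp

/-- Parseval's identity for the remainder of the cosine expansion after `m` terms. -/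
theorem hasSum_sq_cosCoeff_tail {f : ℝ → ℝ} {C : ℝ} (hf : Measurable f)
    (hC : ∀ x ∈ Set.Icc (0 : ℝ) 1, |f x| ≤ C) {c : ℕ → ℝ}
    (hc : ∀ k, 1 ≤ k → ∫ s in (0 : ℝ)..1, f s * Real.cos (freq k * s) = c k) (m : ℕ) :
    HasSum (fun j : ℕ => 2 * c (m + 1 + j) ^ 2)
      (∫ s in (0 : ℝ)..1, (f s - 2 * ∑ k ∈ Finset.Icc 1 m, c k * Real.cos (freq k * s)) ^ 2) := by
  set g : ℝ → ℝ := fun s => 2 * ∑ k ∈ Finset.Icc 1 m, c k * Real.cos (freq k * s) with hg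
  have hgc : Continuous g := by fun_prop
  have hgC (x : ℝ) : |g x| ≤ 2 * ∑ k ∈ Finset.Icc 1 m, |c k| := by
    rw [hg, abs_mul, abs_two]
    gcongr
    refine (Finset.abs_sum_le_sum_abs _ _).trans (Finset.sum_le_sum fun k _ => ?_)
    rw [abs_mul]
    exact mul_le_of_le_one_right (abs_nonneg _) (Real.abs_cos_le_one _)
  have hfi (k : ℕ) : IntervalIntegrable (fun s => f s * Real.cos (freq k * s)) volume 0 1 :=
    (intervalIntegrable_iff_integrableOn_Icc_of_le zero_le_one).2
      (integrableOn_Icc_of_bounded (C := C) (Measurable.stronglyMeasurable (by fun_prop))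
        fun x hx => by
          rw [norm_mul]
          exact (mul_le_of_le_one_right (norm_nonneg _) (Real.abs_cos_le_one _)).trans (hC x hx))
  have hP := hasSum_sq_cosCoeff (f := fun s => f s - g s)
    (C := C + 2 * ∑ k ∈ Finset.Icc 1 m, |c k|) (hf.sub hgc.measurable)
    (fun x hx => (abs_sub _ _).trans (add_le_add (hC x hx) (hgC x)))
  have hcoef (k : ℕ) (hk : 1 ≤ k) :
      ∫ s in (0 : ℝ)..1, (f s - g s) * Real.cos (freq k * s) = if k ≤ m then 0 else c k := by
    simp only [sub_mul]
    rw [intervalIntegral.integral_sub (hfi k) (Continuous.intervalIntegrable (by fun_prop) _ _),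
      hc k hk]
    simp only [hg, mul_assoc, Finset.sum_mul]
    rw [intervalIntegral.integral_const_mul, intervalIntegral.integral_finsetSum
      fun i _ => Continuous.intervalIntegrable (by fun_prop) _ _]
    simp only [intervalIntegral.integral_const_mul]
    rw [Finset.sum_congr rfl fun l hl => by
      rw [integral_cos_mul_cos (Finset.mem_Icc.1 hl).1 hk]]
    simp only [mul_ite, mul_zero, Finset.sum_ite_eq', Finset.mem_Icc, hk, true_and]
    split_ifs <;> ring
  have hP' : HasSum (fun j : ℕ => 2 * (if j + 1 ≤ m then 0 else c (j + 1)) ^ 2)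
      (∫ s in (0 : ℝ)..1, (f s - g s) ^ 2) :=
    hP.congr_fun fun j => by rw [hcoef _ (by omega)]
  rw [← hasSum_nat_add_iff' m] at hP'
  rw [Finset.sum_eq_zero, sub_zero] at hP'
  · refine hP'.congr_fun fun j => ?_
    rw [if_neg (by omega), show j + m + 1 = m + 1 + j by ring]
  · intro j hj
    have := Finset.mem_range.1 hj
    rw [if_pos (by omega)]
    simp

/-! ### Matrix functions -/

section MatrixFunctions

variable {n : ℕ}

open scoped Matrix.Norms.L2Operator in
lemma hasDerivAt_exp_sub_smul (L : Matrix (Fin n) (Fin n) ℝ) (t s : ℝ) :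
    HasDerivAt (fun s : ℝ => NormedSpace.exp ((t - s) • L))
      (-(NormedSpace.exp ((t - s) • L) * L)) s := by
  have h := (hasDerivAt_exp_smul_const L (t - s)).scomp s ((hasDerivAt_id s).const_sub t)
  simpa using! h

open scoped Matrix.Norms.L2Operator in
lemma hasDerivAt_matrix_entry {F : ℝ → Matrix (Fin n) (Fin n) ℝ} {F' : Matrix (Fin n) (Fin n) ℝ}
    {s : ℝ} (h : HasDerivAt F F' s) (i j : Fin n) : HasDerivAt (fun s => F s i j) (F' i j) s :=
  (LinearMap.toContinuousLinearMap (Matrix.entryLinearMap ℝ ℝ i j)).hasFDerivAt.comp_hasDerivAt s h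

lemma hasDerivAt_exp_sub_smul_mul_entry (L M : Matrix (Fin n) (Fin n) ℝ) (t s : ℝ) (i j : Fin n) :
    HasDerivAt (fun s : ℝ => (NormedSpace.exp ((t - s) • L) * M) i j)
      (-(NormedSpace.exp ((t - s) • L) * L * M) i j) s := by
  open scoped Matrix.Norms.L2Operator in
  simpa using! hasDerivAt_matrix_entry ((hasDerivAt_exp_sub_smul L t s).mul_const M) i j

lemma continuous_exp_sub_smul_mul_entry (L M : Matrix (Fin n) (Fin n) ℝ) (t : ℝ) (i j : Fin n) :
    Continuous fun s : ℝ => (NormedSpace.exp ((t - s) • L) * M) i j :=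
  continuous_iff_continuousAt.2 fun s =>
    (hasDerivAt_exp_sub_smul_mul_entry L M t s i j).continuousAt

lemma NegSemidef.isHermitian {L : Matrix (Fin n) (Fin n) ℝ} (hL : NegSemidef L) :
    L.IsHermitian := by
  have h : (-L).IsHermitian := Matrix.PosSemidef.isHermitian hL
  simpa using h.neg

lemma NegSemidef.isUnit_det {L : Matrix (Fin n) (Fin n) ℝ} (hL : NegSemidef L) {c : ℝ}
    (hc : c ≠ 0) : IsUnit (L ^ 2 + c ^ 2 • (1 : Matrix (Fin n) (Fin n) ℝ)).det := by
  have h1 : (L ^ 2).PosSemidef := by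
    have := Matrix.posSemidef_conjTranspose_mul_self L
    rwa [hL.isHermitian.eq, ← pow_two] at this
  have h2 : (c ^ 2 • (1 : Matrix (Fin n) (Fin n) ℝ)).PosDef :=
    Matrix.PosDef.one.smul (by positivity)
  exact (Matrix.isUnit_iff_isUnit_det _).1 (Matrix.PosDef.posSemidef_add h1 h2).isUnit

/-- `φ_{k,t}^{cos}(L) = ∫_0^t cos (λ_k s) e^{(t-s)L} ds`: the coefficients of the kernel
`s ↦ e^{(t-s)L}` of the solution with respect to the functions `cos (λ_k s)`. -/
lemma integral_cos_mul_exp_entry {L : Matrix (Fin n) (Fin n) ℝ} (hL : NegSemidef L)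
    (M : Matrix (Fin n) (Fin n) ℝ) {k : ℕ} (hk : 1 ≤ k) (t : ℝ) (i j : Fin n) :
    ∫ s in (0 : ℝ)..t, (NormedSpace.exp ((t - s) • L) * M) i j * Real.cos (freq k * s) =
      (phiCos k t L * M) i j := by
  set c := freq k with hc
  have hdet := hL.isUnit_det (freq_pos hk).ne'
  set R := L ^ 2 + c ^ 2 • (1 : Matrix (Fin n) (Fin n) ℝ)
  set D := R⁻¹ * M
  have hRD : L * (L * D) + c ^ 2 • D = M := by
    have : R * D = M := Matrix.mul_nonsing_inv_cancel_left _ _ hdet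
    rw [← this, ← Matrix.mul_assoc L L D]
    simp only [R, Matrix.add_mul, Matrix.smul_mul, Matrix.one_mul, pow_two L]
  -- an antiderivative of the integrand
  have hderiv (s : ℝ) : HasDerivAt (fun s : ℝ => (NormedSpace.exp ((t - s) • L) *
      ((c * Real.sin (c * s)) • D - Real.cos (c * s) • (L * D))) i j)
      ((NormedSpace.exp ((t - s) • L) * M) i j * Real.cos (c * s)) s := by
    open scoped Matrix.Norms.L2Operator in
    have hcs : HasDerivAt (fun s : ℝ => c * s) c s := by
      simpa using (hasDerivAt_id s).const_mul c
    have h1 := ((hcs.sin.const_mul c).smul_const D).sub (hcs.cos.smul_const (L * D))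
    have h2 : HasDerivAt (fun s : ℝ => NormedSpace.exp ((t - s) • L) *
        ((c * Real.sin (c * s)) • D - Real.cos (c * s) • (L * D)))
        (Real.cos (c * s) • (NormedSpace.exp ((t - s) • L) * M)) s := by
      refine ((hasDerivAt_exp_sub_smul L t s).mul h1).congr_deriv ?_
      conv_rhs => rw [← hRD]
      simp only [neg_mul, Matrix.mul_sub, Matrix.mul_add, Matrix.mul_smul, Matrix.mul_assoc,
        Pi.sub_apply, smul_add, smul_smul, neg_smul, Matrix.mul_neg]
      module
    refine (hasDerivAt_matrix_entry h2 i j).congr_deriv ?_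
    rw [Matrix.smul_apply, smul_eq_mul, mul_comm]
  rw [intervalIntegral.integral_eq_sub_of_hasDerivAt (fun s _ => hderiv s)
    (((continuous_exp_sub_smul_mul_entry L M t i j).mul (by fun_prop)).intervalIntegrable _ _)]
  have hcomm : L * NormedSpace.exp (t • L) = NormedSpace.exp (t • L) * L := by
    open scoped Matrix.Norms.L2Operator in
    exact (((Commute.refl L).smul_right t).exp_right).eq
  rw [← Matrix.sub_apply, phiCos, hcomm]
  refine congrFun (congrFun ?_ i) j
  simp only [sub_self, zero_smul, NormedSpace.exp_zero, mul_zero, Real.sin_zero, Real.cos_zero,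
    one_smul, sub_zero, zero_sub, Matrix.one_mul, Matrix.mul_assoc, Matrix.sub_mul, Matrix.add_mul,
    Matrix.smul_mul, Matrix.mul_neg, D, R, c]
  abel

/-- `φ_{k,t}^{cos}(L)` acts on the eigenspaces of `L` by the scalar function. -/
lemma phiCos_eq_conj {L : Matrix (Fin n) (Fin n) ℝ} (hL : NegSemidef L) {k : ℕ} (hk : 1 ≤ k)
    (t : ℝ) : phiCos k t L = (hL.isHermitian.eigenvectorUnitary : Matrix (Fin n) (Fin n) ℝ) *
      Matrix.diagonal (fun i => scalarPhi k t (hL.isHermitian.eigenvalues i)) *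
      (hL.isHermitian.eigenvectorUnitary : Matrix (Fin n) (Fin n) ℝ).conjTranspose := by
  set d := hL.isHermitian.eigenvalues
  have hc := freq_pos hk
  have hspec := hL.isHermitian.spectral_theorem
  rw [Unitary.conjStarAlgAut_apply] at hspec
  set U : Matrix (Fin n) (Fin n) ℝ := hL.isHermitian.eigenvectorUnitary.1
  have hUU : U.conjTranspose * U = 1 := Unitary.coe_star_mul_self hL.isHermitian.eigenvectorUnitary
  have hUU' : U * U.conjTranspose = 1 := Unitary.coe_mul_star_self hL.isHermitian.eigenvectorUnitary
  have hinv : U⁻¹ = U.conjTranspose := Matrix.inv_eq_right_inv hUU'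
  have hspec' : L = U * Matrix.diagonal d * U.conjTranspose := hspec
  have hconj (M N : Matrix (Fin n) (Fin n) ℝ) :
      U * M * U.conjTranspose * (U * N * U.conjTranspose) = U * (M * N) * U.conjTranspose := by
    calc _ = U * M * (U.conjTranspose * U) * N * U.conjTranspose := by
          simp only [Matrix.mul_assoc]
      _ = _ := by rw [hUU]; simp only [Matrix.mul_assoc, Matrix.one_mul]
  have hsmul (a : ℝ) (M : Matrix (Fin n) (Fin n) ℝ) :
      a • (U * M * U.conjTranspose) = U * (a • M) * U.conjTranspose := by
    simp only [Matrix.mul_smul, Matrix.smul_mul]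
  have hone : (1 : Matrix (Fin n) (Fin n) ℝ) = U * 1 * U.conjTranspose := by
    rw [Matrix.mul_one, hUU']
  have hexp : NormedSpace.exp (t • L) =
      U * Matrix.diagonal (fun i => Real.exp (t * d i)) * U.conjTranspose := by
    have hunit : IsUnit U := IsUnit.of_mul_eq_one _ hUU'
    rw [hspec', hsmul, ← hinv, Matrix.exp_conj _ _ hunit, ← Matrix.diagonal_smul,
      Matrix.exp_diagonal]
    congr 3
    ext i
    rw [Pi.coe_exp, Real.exp_eq_exp_ℝ]
    rfl
  have hnum : L * NormedSpace.exp (t • L) - Real.cos (freq k * t) • L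
      + (freq k * Real.sin (freq k * t)) • (1 : Matrix (Fin n) (Fin n) ℝ) =
      U * Matrix.diagonal (fun i => d i * Real.exp (t * d i) - Real.cos (freq k * t) * d i
        + freq k * Real.sin (freq k * t)) * U.conjTranspose := by
    rw [hexp, hone]
    nth_rw 1 2 [hspec']
    rw [hconj, hsmul, hsmul, ← Matrix.sub_mul, ← Matrix.mul_sub, ← Matrix.add_mul,
      ← Matrix.mul_add]
    congr 2
    ext i j
    by_cases hij : i = j
    · subst hij; simp
    · simp [hij]
  have hden : (L ^ 2 + freq k ^ 2 • (1 : Matrix (Fin n) (Fin n) ℝ))⁻¹ =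
      U * Matrix.diagonal (fun i => (d i ^ 2 + freq k ^ 2)⁻¹) * U.conjTranspose := by
    apply Matrix.inv_eq_right_inv
    have h1 : L ^ 2 + freq k ^ 2 • (1 : Matrix (Fin n) (Fin n) ℝ) =
        U * Matrix.diagonal (fun i => d i ^ 2 + freq k ^ 2) * U.conjTranspose := by
      rw [pow_two, hone]
      nth_rw 1 2 [hspec']
      rw [hconj, hsmul, ← Matrix.add_mul, ← Matrix.mul_add]
      congr 2
      ext i j
      by_cases hij : i = j
      · subst hij; simp [pow_two]
      · simp [hij]
    rw [h1, hconj, Matrix.diagonal_mul_diagonal]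
    conv_rhs => rw [hone]
    congr 2
    rw [← Matrix.diagonal_one]
    congr 1
    ext i
    exact mul_inv_cancel₀ (by positivity)
  rw [phiCos, hnum, hden, hconj, Matrix.diagonal_mul_diagonal]
  congr 3

lemma frobeniusNorm_sq (A : Matrix (Fin n) (Fin n) ℝ) :
    frobeniusNorm A ^ 2 = ∑ i, ∑ j, A i j ^ 2 := by
  rw [frobeniusNorm, Matrix.frobenius_norm_def, ← Real.sqrt_eq_rpow, Real.sq_sqrt (by positivity)]
  simp

lemma sum_sq_eq_trace (A : Matrix (Fin n) (Fin n) ℝ) :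
    ∑ i, ∑ j, A i j ^ 2 = (A.conjTranspose * A).trace := by
  rw [Finset.sum_comm]
  simp [Matrix.trace, Matrix.mul_apply, pow_two]

/-- The Frobenius norm of `φ_{k,t}^{cos}(L) B` in terms of the eigenvalues of `L`. -/
lemma frobeniusNorm_phiCos_mul_sq_le {L : Matrix (Fin n) (Fin n) ℝ} (hL : NegSemidef L)
    (B : Matrix (Fin n) (Fin n) ℝ) {k : ℕ} (hk : 1 ≤ k) (t : ℝ) :
    frobeniusNorm (phiCos k t L * B) ^ 2 ≤
      euclOpNorm B ^ 2 * ∑ i, scalarPhi k t (hL.isHermitian.eigenvalues i) ^ 2 := by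
  rw [frobeniusNorm_sq, phiCos_eq_conj hL hk]
  set d := hL.isHermitian.eigenvalues
  set V := hL.isHermitian.eigenvectorUnitary
  set U : Matrix (Fin n) (Fin n) ℝ := V.1
  have hUU : U.conjTranspose * U = 1 := Unitary.coe_star_mul_self V
  set D := Matrix.diagonal fun i => scalarPhi k t (d i)
  have h1 : ∑ i, ∑ j, (U * D * U.conjTranspose * B) i j ^ 2 =
      ∑ i, ∑ j, (D * (U.conjTranspose * B)) i j ^ 2 := by
    rw [sum_sq_eq_trace, sum_sq_eq_trace, show U * D * U.conjTranspose * B =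
      U * (D * (U.conjTranspose * B)) by simp only [Matrix.mul_assoc],
      Matrix.conjTranspose_mul U, Matrix.mul_assoc, ← Matrix.mul_assoc U.conjTranspose U, hUU,
      Matrix.one_mul]
  rw [h1, Finset.mul_sum]
  refine Finset.sum_le_sum fun i _ => ?_
  simp only [D, Matrix.diagonal_mul, mul_pow, ← Finset.mul_sum]
  rw [mul_comm]
  refine mul_le_mul_of_nonneg_right ?_ (sq_nonneg _)
  -- the `i`-th row of `Uᵀ B` is the image under `Bᵀ` of the `i`-th eigenvector
  set u : EuclideanSpace ℝ (Fin n) := hL.isHermitian.eigenvectorBasis i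
  have hu : ‖u‖ = 1 := hL.isHermitian.eigenvectorBasis.orthonormal.1 i
  have h2 : euclOpNorm B = euclOpNorm B.conjTranspose := (Matrix.l2_opNorm_conjTranspose B).symm
  have h3 : ‖WithLp.toLp 2 (B.conjTranspose.mulVec u.ofLp)‖ ≤ euclOpNorm B.conjTranspose * ‖u‖ :=
    Matrix.l2_opNorm_mulVec _ _
  have h4 : ∑ j, (U.conjTranspose * B) i j ^ 2 =
      ‖WithLp.toLp 2 (B.conjTranspose.mulVec u.ofLp)‖ ^ 2 := by
    rw [EuclideanSpace.norm_sq_eq]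
    refine Finset.sum_congr rfl fun j _ => ?_
    rw [Real.norm_eq_abs, sq_abs]
    congr 1
    simp only [Matrix.mul_apply, Matrix.mulVec, dotProduct, Matrix.conjTranspose_apply, star_trivial]
    exact Finset.sum_congr rfl fun l _ => mul_comm _ _
  rw [h4, h2]
  rw [hu, mul_one] at h3
  exact pow_le_pow_left₀ (norm_nonneg _) h3 2

lemma NegSemidef.eigenvalues_nonpos {L : Matrix (Fin n) (Fin n) ℝ} (hL : NegSemidef L)
    (i : Fin n) : hL.isHermitian.eigenvalues i ≤ 0 := by
  rw [hL.isHermitian.eigenvalues_eq i]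
  have := hL.re_dotProduct_nonneg (hL.isHermitian.eigenvectorBasis i).ofLp
  simp only [Matrix.neg_mulVec, dotProduct_neg] at this
  simpa using this

/-- The tail of the series for the mean square error. -/
theorem sum_frobeniusNorm_phiCos_le {L : Matrix (Fin n) (Fin n) ℝ} (hL : NegSemidef L)
    (B : Matrix (Fin n) (Fin n) ℝ) {m : ℕ} (hm : 2 ≤ m) {t : ℝ} (ht : 0 ≤ t) (N : ℕ) :
    ∑ j ∈ Finset.range N, 2 * frobeniusNorm (phiCos (m + 1 + j) t L * B) ^ 2 ≤
      2 * euclOpNorm B ^ 2 / Real.pi ^ 2 * (n / ((m : ℝ) - 1)) := by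
  calc ∑ j ∈ Finset.range N, 2 * frobeniusNorm (phiCos (m + 1 + j) t L * B) ^ 2
      ≤ ∑ j ∈ Finset.range N, 2 * (euclOpNorm B ^ 2 *
          ∑ i, scalarPhi (m + 1 + j) t (hL.isHermitian.eigenvalues i) ^ 2) := by
        gcongr
        exact frobeniusNorm_phiCos_mul_sq_le hL B (by omega) t
    _ = 2 * euclOpNorm B ^ 2 * ∑ i, ∑ j ∈ Finset.range N,
          scalarPhi (m + 1 + j) t (-(-hL.isHermitian.eigenvalues i)) ^ 2 := by
        simp only [neg_neg]
        rw [Finset.sum_comm, ← Finset.mul_sum, ← Finset.mul_sum, mul_assoc]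
    _ ≤ 2 * euclOpNorm B ^ 2 * ∑ _i : Fin n, 1 / Real.pi ^ 2 * (1 / ((m : ℝ) - 1)) := by
        gcongr with i
        exact sum_sq_scalarPhi_le hm ht (by linarith [hL.eigenvalues_nonpos i]) N
    _ = _ := by
        simp only [Finset.sum_const, Finset.card_univ, Fintype.card_fin, nsmul_eq_mul]
        ring

end MatrixFunctions

/-! ### Second moments of time integrals of the Wiener process -/

/-- A process with almost surely continuous paths agrees, almost surely at all times, with a
jointly measurable process. The time set is extended to `ℝ` by `Real.toNNReal`. -/
lemma exists_measurable_version {Ω : Type*} [MeasurableSpace Ω] {P : Measure Ω}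
    {Y : ℝ≥0 → Ω → ℝ} (hY : ∀ t, AEMeasurable (Y t) P) (hc : ∀ᵐ ω ∂P, Continuous fun t => Y t ω) :
    ∃ y : ℝ → Ω → ℝ, Measurable (Function.uncurry y) ∧
      ∀ᵐ ω ∂P, ∀ s, y s ω = Y s.toNNReal ω := by
  set d := TopologicalSpace.denseSeq ℝ≥0
  have hgood : ∀ᵐ ω ∂P, (Continuous fun t => Y t ω) ∧ ∀ k, Y (d k) ω = (hY (d k)).mk _ ω :=
    hc.and (ae_all_iff.2 fun k => (hY (d k)).ae_eq_mk)
  set S := (toMeasurable P {ω | ¬((Continuous fun t => Y t ω) ∧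
    ∀ k, Y (d k) ω = (hY (d k)).mk _ ω)})ᶜ with hS
  have hSm : MeasurableSet S := (measurableSet_toMeasurable _ _).compl
  have hSP : ∀ᵐ ω ∂P, ω ∈ S := by
    rw [ae_iff]
    simp only [hS, Set.mem_compl_iff, not_not, Set.ofPred_mem_eq, measure_toMeasurable]
    exact hgood
  have hSg (ω : Ω) (h : ω ∈ S) : (Continuous fun t => Y t ω) ∧
      ∀ k, Y (d k) ω = (hY (d k)).mk _ ω := by
    by_contra h'
    exact h (subset_toMeasurable _ _ h')
  -- On `S` the paths are limits of their values at the countably many times `d k`.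
  have hmeas (t : ℝ≥0) : Measurable (S.indicator (Y t)) := by
    obtain ⟨u, hu, hut⟩ := mem_closure_iff_seq_limit.1
      ((TopologicalSpace.denseRange_denseSeq ℝ≥0).closure_range ▸ Set.mem_univ t)
    refine measurable_of_tendsto_metrizable (f := fun j => S.indicator (Y (u j))) (fun j => ?_) ?_
    · obtain ⟨k, hk⟩ := hu j
      rw [← hk]
      have : S.indicator (Y (d k)) = S.indicator ((hY (d k)).mk _) := by
        refine Set.indicator_congr fun ω h => (hSg ω h).2 k
      rw [this]
      exact (hY (d k)).measurable_mk.indicator hSm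
    · rw [tendsto_pi_nhds]
      intro ω
      by_cases h : ω ∈ S
      · simp only [Set.indicator_of_mem h]
        exact ((hSg ω h).1.tendsto t).comp hut
      · simp only [Set.indicator_of_notMem h]
        exact tendsto_const_nhds
  refine ⟨fun s => S.indicator (Y s.toNNReal), ?_, ?_⟩
  · refine measurable_uncurry_of_continuous_of_measurable (fun ω => ?_) fun s => hmeas _
    by_cases h : ω ∈ S
    · simp only [Set.indicator_of_mem h]
      exact (hSg ω h).1.comp continuous_real_toNNReal
    · simp only [Set.indicator_of_notMem h]
      exact continuous_const
  · filter_upwards [hSP] with ω h s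
    rw [Set.indicator_of_mem h]

lemma abs_integral_mul_le {Ω : Type*} [MeasurableSpace Ω] {P : Measure Ω} {f g : Ω → ℝ} {C : ℝ}
    (hf : MemLp f 2 P) (hg : MemLp g 2 P) (hfC : ∫ ω, f ω ^ 2 ∂P ≤ C) (hgC : ∫ ω, g ω ^ 2 ∂P ≤ C) :
    ∫ ω, ‖f ω * g ω‖ ∂P ≤ C := by
  calc ∫ ω, ‖f ω * g ω‖ ∂P ≤ ∫ ω, (1 / 2 * f ω ^ 2 + 1 / 2 * g ω ^ 2) ∂P := by
        refine integral_mono (hf.integrable_mul hg).norm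
          ((hf.integrable_sq.const_mul _).add (hg.integrable_sq.const_mul _)) fun ω => ?_
        simp only [norm_mul, Real.norm_eq_abs]
        nlinarith [sq_nonneg (|f ω| - |g ω|), sq_abs (f ω), sq_abs (g ω)]
    _ ≤ C := by
        rw [integral_add (hf.integrable_sq.const_mul _) (hg.integrable_sq.const_mul _),
          integral_const_mul, integral_const_mul]
        linarith

/-- Second moments of time integrals of processes, by Fubini's theorem. -/
theorem integral_mul_integral {Ω : Type*} [MeasurableSpace Ω] {P : Measure Ω} [IsFiniteMeasure P]
    {μ : Measure ℝ} [IsFiniteMeasure μ] {U V : ℝ → Ω → ℝ} {C : ℝ}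
    (hU : Measurable (Function.uncurry U)) (hV : Measurable (Function.uncurry V))
    (hU2 : ∀ᵐ s ∂μ, MemLp (U s) 2 P ∧ ∫ ω, U s ω ^ 2 ∂P ≤ C)
    (hV2 : ∀ᵐ s ∂μ, MemLp (V s) 2 P ∧ ∫ ω, V s ω ^ 2 ∂P ≤ C) :
    Integrable (fun ω => (∫ s, U s ω ∂μ) * ∫ u, V u ω ∂μ) P ∧
      ∫ ω, (∫ s, U s ω ∂μ) * (∫ u, V u ω ∂μ) ∂P =
        ∫ z, ∫ ω, U z.1 ω * V z.2 ω ∂P ∂(μ.prod μ) := by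
  have hmeas : Measurable fun p : (ℝ × ℝ) × Ω => U p.1.1 p.2 * V p.1.2 p.2 :=
    (hU.comp (f := fun p : (ℝ × ℝ) × Ω => (p.1.1, p.2)) (by fun_prop)).mul
      (hV.comp (f := fun p : (ℝ × ℝ) × Ω => (p.1.2, p.2)) (by fun_prop))
  have hae : ∀ᵐ z ∂(μ.prod μ), (MemLp (U z.1) 2 P ∧ ∫ ω, U z.1 ω ^ 2 ∂P ≤ C) ∧
      (MemLp (V z.2) 2 P ∧ ∫ ω, V z.2 ω ^ 2 ∂P ≤ C) :=
    (Measure.quasiMeasurePreserving_fst.ae hU2).and (Measure.quasiMeasurePreserving_snd.ae hV2)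
  have hint : Integrable (fun p : (ℝ × ℝ) × Ω => U p.1.1 p.2 * V p.1.2 p.2)
      ((μ.prod μ).prod P) := by
    rw [integrable_prod_iff hmeas.aestronglyMeasurable]
    constructor
    · filter_upwards [hae] with z hz using hz.1.1.integrable_mul hz.2.1
    · refine Integrable.of_bound (C := C)
        hmeas.stronglyMeasurable.norm.integral_prod_right'.aestronglyMeasurable ?_
      filter_upwards [hae] with z hz
      rw [Real.norm_of_nonneg (integral_nonneg fun _ => norm_nonneg _)]
      exact abs_integral_mul_le hz.1.1 hz.2.1 hz.1.2 hz.2.2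
  have hprod (ω : Ω) : (∫ s, U s ω ∂μ) * (∫ u, V u ω ∂μ) =
      ∫ z, U z.1 ω * V z.2 ω ∂(μ.prod μ) := (integral_prod_mul _ _).symm
  simp only [hprod]
  exact ⟨hint.integral_prod_right, (integral_integral_swap hint).symm⟩

/-- The covariance function `min s u` of the Wiener process is also that of the indicators
`v ↦ 1_{v ≤ s}` on the probability space `(0, 1]`. Second moments of weighted time integrals depend
on the covariance function only, so those for the Wiener process are integrals over `(0, 1]`. -/
theorem integral_sq_integral_of_covariance {Ω : Type*} [MeasurableSpace Ω] {P : Measure Ω}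
    [IsFiniteMeasure P] {μ : Measure ℝ} [IsFiniteMeasure μ] (hμ : ∀ᵐ s ∂μ, s ∈ Set.Icc (0 : ℝ) 1)
    {w : ℝ → Ω → ℝ} (hw : Measurable (Function.uncurry w))
    (hw2 : ∀ s ∈ Set.Icc (0 : ℝ) 1, MemLp (w s) 2 P)
    (hcov : ∀ s ∈ Set.Icc (0 : ℝ) 1, ∀ u ∈ Set.Icc (0 : ℝ) 1,
      ∫ ω, w s ω * w u ω ∂P = min s u)
    {f : ℝ → ℝ} {C : ℝ} (hf : Measurable f) (hC : ∀ s ∈ Set.Icc (0 : ℝ) 1, |f s| ≤ C) :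
    Integrable (fun ω => (∫ s, f s * w s ω ∂μ) ^ 2) P ∧
    ∫ ω, (∫ s, f s * w s ω ∂μ) ^ 2 ∂P =
      ∫ v in (0 : ℝ)..1, (∫ s, f s * (if v ≤ s then 1 else 0) ∂μ) ^ 2 := by
  have hsq (s : ℝ) (hs : s ∈ Set.Icc (0 : ℝ) 1) : f s ^ 2 ≤ C ^ 2 := by
    rw [← sq_abs (f s)]; exact pow_le_pow_left₀ (abs_nonneg _) (hC s hs) 2
  have hI : Measurable (Function.uncurry fun s v : ℝ => f s * (if v ≤ s then (1 : ℝ) else 0)) :=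
    (hf.comp measurable_fst).mul
      (Measurable.ite (measurableSet_le measurable_snd measurable_fst) measurable_const
        measurable_const)
  have hIm (s : ℝ) : Measurable fun v : ℝ => (if v ≤ s then (1 : ℝ) else 0) :=
    Measurable.ite (measurableSet_le measurable_id measurable_const) measurable_const
      measurable_const
  have hIL (s : ℝ) : MemLp (fun v : ℝ => (if v ≤ s then (1 : ℝ) else 0)) 2
      (volume.restrict (Set.Ioc (0 : ℝ) 1)) :=
    MemLp.of_bound (hIm s).aestronglyMeasurable 1 (ae_of_all _ fun v => by
      split_ifs <;> simp)
  have hIcov (s u : ℝ) (hs : s ∈ Set.Icc (0 : ℝ) 1) (hu : u ∈ Set.Icc (0 : ℝ) 1) :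
      ∫ v in Set.Ioc (0 : ℝ) 1, (if v ≤ s then (1 : ℝ) else 0) * (if v ≤ u then (1 : ℝ) else 0) =
        min s u := by
    have h0 : 0 ≤ min s u := le_min hs.1 hu.1
    have h1 : min s u ≤ 1 := (min_le_left _ _).trans hs.2
    have : ∀ v : ℝ, (if v ≤ s then (1 : ℝ) else 0) * (if v ≤ u then (1 : ℝ) else 0) =
        (Set.Iic (min s u)).indicator (fun _ => 1) v := fun v => by
      simp only [Set.indicator_apply, Set.mem_Iic, le_min_iff]
      split_ifs <;> simp_all
    simp only [this]
    rw [setIntegral_indicator measurableSet_Iic, setIntegral_const, smul_eq_mul, mul_one]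
    have : Set.Ioc (0 : ℝ) 1 ∩ Set.Iic (min s u) = Set.Ioc 0 (min s u) := by
      ext v; simp only [Set.mem_inter_iff, Set.mem_Ioc, Set.mem_Iic]
      exact ⟨fun h => ⟨h.1.1, h.2⟩, fun h => ⟨⟨h.1, h.2.trans h1⟩, h.2⟩⟩
    rw [this, measureReal_def, Real.volume_Ioc, ENNReal.toReal_ofReal (by linarith), sub_zero]
  have hA := integral_mul_integral (P := P) (μ := μ) (C := C ^ 2)
    (U := fun s ω => f s * w s ω) (V := fun s ω => f s * w s ω)
    ((hf.comp measurable_fst).mul hw) ((hf.comp measurable_fst).mul hw)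
    (by
      filter_upwards [hμ] with s hs
      refine ⟨(hw2 s hs).const_mul _, ?_⟩
      simp only [mul_pow, integral_const_mul]
      have := hcov s hs s hs
      simp only [← pow_two, min_self] at this
      rw [this]
      nlinarith [hsq s hs, sq_nonneg (f s), hs.1, hs.2])
    (by
      filter_upwards [hμ] with s hs
      refine ⟨(hw2 s hs).const_mul _, ?_⟩
      simp only [mul_pow, integral_const_mul]
      have := hcov s hs s hs
      simp only [← pow_two, min_self] at this
      rw [this]
      nlinarith [hsq s hs, sq_nonneg (f s), hs.1, hs.2])
  have hbI : ∀ᵐ s ∂μ, MemLp (fun v => f s * (if v ≤ s then (1 : ℝ) else 0)) 2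
      (volume.restrict (Set.Ioc (0 : ℝ) 1)) ∧
      ∫ v in Set.Ioc (0 : ℝ) 1, (f s * (if v ≤ s then (1 : ℝ) else 0)) ^ 2 ≤ C ^ 2 := by
    filter_upwards [hμ] with s hs
    refine ⟨(hIL s).const_mul _, ?_⟩
    simp only [mul_pow, integral_const_mul]
    have := hIcov s s hs hs
    simp only [← pow_two, min_self] at this
    rw [this]
    nlinarith [hsq s hs, sq_nonneg (f s), hs.1, hs.2]
  have hB := integral_mul_integral (P := volume.restrict (Set.Ioc (0 : ℝ) 1)) (μ := μ)
    (C := C ^ 2) hI hI hbI hbI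
  simp only [← pow_two] at hA hB
  refine ⟨hA.1, ?_⟩
  rw [hA.2, intervalIntegral.integral_of_le zero_le_one, hB.2]
  refine integral_congr_ae ?_
  filter_upwards [Measure.quasiMeasurePreserving_fst.ae hμ,
    Measure.quasiMeasurePreserving_snd.ae hμ] with z h1 h2
  have e1 (ω : Ω) : f z.1 * w z.1 ω * (f z.2 * w z.2 ω) =
      (f z.1 * f z.2) * (w z.1 ω * w z.2 ω) := by ring
  have e2 (v : ℝ) : f z.1 * (if v ≤ z.1 then (1 : ℝ) else 0) *
      (f z.2 * (if v ≤ z.2 then (1 : ℝ) else 0)) = (f z.1 * f z.2) *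
        ((if v ≤ z.1 then (1 : ℝ) else 0) * (if v ≤ z.2 then (1 : ℝ) else 0)) := by ring
  simp only [e1, e2, integral_const_mul]
  rw [hcov _ h1 _ h2, hIcov _ _ h1 h2]

/-- Weighted time integrals of uncorrelated processes are uncorrelated. -/
theorem integral_mul_integral_eq_zero {Ω : Type*} [MeasurableSpace Ω] {P : Measure Ω}
    [IsFiniteMeasure P] {μ : Measure ℝ} [IsFiniteMeasure μ] (hμ : ∀ᵐ s ∂μ, s ∈ Set.Icc (0 : ℝ) 1)
    {w w' : ℝ → Ω → ℝ} (hw : Measurable (Function.uncurry w))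
    (hw' : Measurable (Function.uncurry w'))
    (hw2 : ∀ s ∈ Set.Icc (0 : ℝ) 1, MemLp (w s) 2 P ∧ ∫ ω, w s ω ^ 2 ∂P ≤ 1)
    (hw2' : ∀ s ∈ Set.Icc (0 : ℝ) 1, MemLp (w' s) 2 P ∧ ∫ ω, w' s ω ^ 2 ∂P ≤ 1)
    (hcov : ∀ s ∈ Set.Icc (0 : ℝ) 1, ∀ u ∈ Set.Icc (0 : ℝ) 1, ∫ ω, w s ω * w' u ω ∂P = 0)
    {f f' : ℝ → ℝ} {C : ℝ} (hf : Measurable f) (hC : ∀ s ∈ Set.Icc (0 : ℝ) 1, |f s| ≤ C)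
    (hf' : Measurable f') (hC' : ∀ s ∈ Set.Icc (0 : ℝ) 1, |f' s| ≤ C) :
    Integrable (fun ω => (∫ s, f s * w s ω ∂μ) * ∫ s, f' s * w' s ω ∂μ) P ∧
    ∫ ω, (∫ s, f s * w s ω ∂μ) * (∫ s, f' s * w' s ω ∂μ) ∂P = 0 := by
  have aux {g : ℝ → ℝ} {y : ℝ → Ω → ℝ} (hg : ∀ s ∈ Set.Icc (0 : ℝ) 1, |g s| ≤ C)
      (hy : ∀ s ∈ Set.Icc (0 : ℝ) 1, MemLp (y s) 2 P ∧ ∫ ω, y s ω ^ 2 ∂P ≤ 1) :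
      ∀ᵐ s ∂μ, MemLp (fun ω => g s * y s ω) 2 P ∧ ∫ ω, (g s * y s ω) ^ 2 ∂P ≤ C ^ 2 := by
    filter_upwards [hμ] with s hs
    refine ⟨(hy s hs).1.const_mul _, ?_⟩
    simp only [mul_pow, integral_const_mul]
    have h1 : g s ^ 2 ≤ C ^ 2 := by
      rw [← sq_abs (g s)]; exact pow_le_pow_left₀ (abs_nonneg _) (hg s hs) 2
    nlinarith [(hy s hs).2, sq_nonneg (g s)]
  have hA := integral_mul_integral (P := P) (μ := μ) (C := C ^ 2)
    (U := fun s ω => f s * w s ω) (V := fun s ω => f' s * w' s ω)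
    ((hf.comp measurable_fst).mul hw) ((hf'.comp measurable_fst).mul hw')
    (aux hC hw2) (aux hC' hw2')
  refine ⟨hA.1, ?_⟩
  rw [hA.2]
  refine integral_eq_zero_of_ae ?_
  filter_upwards [Measure.quasiMeasurePreserving_fst.ae hμ,
    Measure.quasiMeasurePreserving_snd.ae hμ] with z h1 h2
  have e (ω : Ω) : f z.1 * w z.1 ω * (f' z.2 * w' z.2 ω) =
      (f z.1 * f' z.2) * (w z.1 ω * w' z.2 ω) := by ring
  simp only [e, integral_const_mul]
  rw [hcov _ h1 _ h2]
  simp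

/-- Jointly measurable versions of the coordinates of a Wiener process. -/
theorem IsWienerProcess.exists_version {n : ℕ} {Ω : Type*} [MeasurableSpace Ω] {P : Measure Ω}
    [IsProbabilityMeasure P] {W : ℝ≥0 → Ω → EuclideanSpace ℝ (Fin n)} (hW : IsWienerProcess W P) :
    ∃ w : Fin n → ℝ → Ω → ℝ, (∀ j, Measurable (Function.uncurry (w j))) ∧
      (∀ j s, MemLp (w j s) 2 P) ∧
      (∀ i j s u, 0 ≤ s → 0 ≤ u → ∫ ω, w i s ω * w j u ω ∂P = if i = j then min s u else 0) ∧
      (∀ᵐ ω ∂P, ∀ j s, w j s ω = W s.toNNReal ω j) := by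
  choose w hwm hwW using fun j => exists_measurable_version
    (fun t => (hW.brownian j).aemeasurable t) (hW.brownian j).cont
  have hall : ∀ᵐ ω ∂P, ∀ j s, w j s ω = W s.toNNReal ω j := ae_all_iff.2 hwW
  have heq (j : Fin n) (s : ℝ) : w j s =ᵐ[P] fun ω => W s.toNNReal ω j := by
    filter_upwards [hall] with ω h using h j s
  have hL2 (j : Fin n) (t : ℝ≥0) : MemLp (fun ω => W t ω j) 2 P :=
    ((hW.brownian j).hasLaw_eval t).hasGaussianLaw.memLp_two
  refine ⟨w, hwm, fun j s => (memLp_congr_ae (heq j s)).2 (hL2 j _), ?_, hall⟩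
  intro i j s u hs hu
  have h1 : ∫ ω, w i s ω * w j u ω ∂P = ∫ ω, W s.toNNReal ω i * W u.toNNReal ω j ∂P :=
    integral_congr_ae ((heq i s).mul (heq j u))
  have h0 (j : Fin n) (t : ℝ≥0) : ∫ ω, W t ω j ∂P = 0 := (hW.brownian j).integral_eval t
  rw [h1]
  split_ifs with hij
  · subst hij
    have hcov := (hW.brownian i).covariance_fun_eval s.toNNReal u.toNNReal
    rw [covariance_eq_sub (hL2 i _) (hL2 i _), h0, zero_mul, sub_zero] at hcov
    simp only [Pi.mul_apply] at hcov
    rw [hcov, NNReal.coe_min, Real.coe_toNNReal _ hs, Real.coe_toNNReal _ hu]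
  · have hind : IndepFun (fun ω => W s.toNNReal ω i) (fun ω => W u.toNNReal ω j) P :=
      (hW.indep.indepFun hij).comp (measurable_pi_apply s.toNNReal)
        (measurable_pi_apply u.toNNReal)
    rw [hind.integral_fun_mul_eq_mul_integral (hL2 i _).aestronglyMeasurable
      (hL2 j _).aestronglyMeasurable, h0, zero_mul]

/-! ### Variation of constants and the weights of the truncation error -/

section Solution

variable {n : ℕ}

/-- Variation of constants for `x' = L x + B w'`, with the derivative of `w` removed by an
integration by parts. -/
theorem eq_variation_of_constants (L B : Matrix (Fin n) (Fin n) ℝ) {x w : ℝ → Fin n → ℝ}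
    (hx : Continuous x) (hw : Continuous w)
    (h : ∀ s, 0 ≤ s → ∀ i, x s i = x 0 i + (∫ u in (0 : ℝ)..s, L.mulVec (x u) i)
      + B.mulVec (w s) i) {t : ℝ} (ht : 0 ≤ t) (i : Fin n) :
    x t i = (NormedSpace.exp (t • L)).mulVec (x 0) i + ∑ j, (B i j * w t j
      + ∫ s in (0 : ℝ)..t, (NormedSpace.exp ((t - s) • L) * (L * B)) i j * w s j) := by
  have hxj (j : Fin n) : Continuous fun s => x s j := (continuous_apply j).comp hx
  have hwj (j : Fin n) : Continuous fun s => w s j := (continuous_apply j).comp hw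
  have hLx (j : Fin n) : Continuous fun u => L.mulVec (x u) j := by
    simp only [Matrix.mulVec, dotProduct]; fun_prop
  set v : ℝ → Fin n → ℝ := fun s j => ∫ u in (0 : ℝ)..s, L.mulVec (x u) j with hv
  have hvd (j : Fin n) (s : ℝ) : HasDerivAt (fun s => v s j) (L.mulVec (x s) j) s :=
    intervalIntegral.integral_hasDerivAt_right ((hLx j).intervalIntegrable _ _)
      ((hLx j).stronglyMeasurableAtFilter _ _) (hLx j).continuousAt
  have hF (s : ℝ) (hs : s ∈ Set.uIcc 0 t) : HasDerivAt
      (fun s => ∑ j, (NormedSpace.exp ((t - s) • L)) i j * (x 0 j + v s j))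
      (∑ j, (NormedSpace.exp ((t - s) • L) * (L * B)) i j * w s j) s := by
    rw [Set.uIcc_of_le ht] at hs
    have hA (j : Fin n) := hasDerivAt_exp_sub_smul_mul_entry L 1 t s i j
    simp only [Matrix.mul_one] at hA
    refine (HasDerivAt.fun_sum fun j _ => (hA j).mul ((hvd j s).const_add (x 0 j))).congr_deriv ?_
    set A := NormedSpace.exp ((t - s) • L)
    have h1 : (fun j => x 0 j + v s j) = x s - B.mulVec (w s) := by
      ext j
      rw [Pi.sub_apply, h s hs.1 j]
      simp [hv]
    have h2 : (-(A * L)).mulVec (x s - B.mulVec (w s)) + A.mulVec (L.mulVec (x s)) =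
        (A * (L * B)).mulVec (w s) := by
      simp only [Matrix.mulVec_sub, Matrix.mulVec_mulVec, Matrix.neg_mul, Matrix.neg_mulVec,
        Matrix.mul_assoc]
      abel
    have h3 := congrFun h2 i
    rw [← h1] at h3
    rw [Finset.sum_add_distrib]
    simpa only [Pi.add_apply, Matrix.mulVec, dotProduct] using! h3
  have hint (j : Fin n) : Continuous fun s : ℝ =>
      (NormedSpace.exp ((t - s) • L) * (L * B)) i j * w s j :=
    (continuous_exp_sub_smul_mul_entry L (L * B) t i j).mul (hwj j)
  have hFTC := intervalIntegral.integral_eq_sub_of_hasDerivAt hF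
    ((continuous_finsetSum _ fun j _ => hint j).intervalIntegrable _ _)
  rw [intervalIntegral.integral_finsetSum fun j _ => (hint j).intervalIntegrable _ _] at hFTC
  simp only [sub_self, zero_smul, NormedSpace.exp_zero, sub_zero, hv,
    intervalIntegral.integral_same, add_zero, Matrix.one_apply, ite_mul, one_mul, zero_mul,
    Finset.sum_ite_eq, Finset.mem_univ, if_true] at hFTC
  rw [h t ht i, Finset.sum_add_distrib, hFTC]
  simp only [Matrix.mulVec, dotProduct]
  ring

/-- Lebesgue measure on `(0, 1]` plus a unit mass at `t`: the measure for which the truncation error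
at time `t` is a weighted time integral of `W`. -/
noncomputable def errorMeasure (t : ℝ) : Measure ℝ := volume.restrict (Set.Ioc 0 1) + Measure.dirac t

instance (t : ℝ) : IsFiniteMeasure (errorMeasure t) := by
  unfold errorMeasure; infer_instance

lemma ae_errorMeasure {t : ℝ} (ht : t ∈ Set.Icc (0 : ℝ) 1) :
    ∀ᵐ s ∂(errorMeasure t), s ∈ Set.Icc (0 : ℝ) 1 := by
  rw [errorMeasure, ae_add_measure_iff]
  refine ⟨?_, ?_⟩
  · filter_upwards [ae_restrict_mem measurableSet_Ioc] with s hs using Set.Ioc_subset_Icc_self hs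
  · exact (ae_dirac_iff (p := fun s => s ∈ Set.Icc (0 : ℝ) 1) measurableSet_Icc).2 ht

/-- The weight of the `j`-th coordinate of `W` in the `i`-th coordinate of the truncation error,
with respect to `errorMeasure t`. The value at `t` is the weight of `W_t` itself. -/
noncomputable def errorWeight (L B : Matrix (Fin n) (Fin n) ℝ) (m : ℕ) (t : ℝ) (i j : Fin n)
    (s : ℝ) : ℝ :=
  if s = t then B i j else
    (if s ≤ t then (NormedSpace.exp ((t - s) • L) * (L * B)) i j else 0)
      - 2 * ∑ k ∈ Finset.Icc 1 m, (phiCos k t L * B) i j * (freq k * Real.sin (freq k * s))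

lemma measurable_errorWeight (L B : Matrix (Fin n) (Fin n) ℝ) (m : ℕ) (t : ℝ) (i j : Fin n) :
    Measurable (errorWeight L B m t i j) := by
  refine Measurable.ite (measurableSet_singleton t) measurable_const (Measurable.sub ?_ ?_)
  · exact Measurable.ite measurableSet_Iic
      (continuous_exp_sub_smul_mul_entry L (L * B) t i j).measurable measurable_const
  · exact Continuous.measurable (by fun_prop)

lemma exists_bound_of_continuous {g : ℝ → ℝ} (hg : Continuous g) :
    ∃ C, 0 ≤ C ∧ ∀ s ∈ Set.Icc (0 : ℝ) 1, |g s| ≤ C := by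
  obtain ⟨C, hC⟩ := isCompact_Icc.exists_bound_of_continuousOn hg.continuousOn
  exact ⟨max C 0, le_max_right _ _, fun s hs => (hC s hs).trans (le_max_left _ _)⟩

lemma exists_bound_errorWeight (L B : Matrix (Fin n) (Fin n) ℝ) (m : ℕ) (t : ℝ) :
    ∃ C, ∀ i j, ∀ s ∈ Set.Icc (0 : ℝ) 1, |errorWeight L B m t i j s| ≤ C := by
  have h (i j : Fin n) : ∃ C, ∀ s ∈ Set.Icc (0 : ℝ) 1, |errorWeight L B m t i j s| ≤ C := by
    obtain ⟨C, hC0, hC⟩ := exists_bound_of_continuous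
      (continuous_exp_sub_smul_mul_entry L (L * B) t i j)
    obtain ⟨D, hD0, hD⟩ := exists_bound_of_continuous (g := fun s =>
      2 * ∑ k ∈ Finset.Icc 1 m, (phiCos k t L * B) i j * (freq k * Real.sin (freq k * s)))
      (by fun_prop)
    refine ⟨|B i j| + (C + D), fun s hs => ?_⟩
    unfold errorWeight
    split_ifs with h1 h2
    · linarith
    · refine (abs_sub _ _).trans ?_
      linarith [hC s hs, hD s hs, abs_nonneg (B i j)]
    · rw [zero_sub, abs_neg]
      linarith [hD s hs, abs_nonneg (B i j)]
  choose C hC using h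
  refine ⟨∑ i, ∑ j, |C i j|, fun i j s hs => (hC i j s hs).trans ((le_abs_self _).trans ?_)⟩
  exact (Finset.single_le_sum (f := fun j => |C i j|) (fun _ _ => abs_nonneg _)
    (Finset.mem_univ j)).trans (Finset.single_le_sum (f := fun i => ∑ j, |C i j|)
    (fun _ _ => Finset.sum_nonneg fun _ _ => abs_nonneg _) (Finset.mem_univ i))

lemma intervalIntegrable_mul_of_bounded {g y : ℝ → ℝ} (hg : Continuous g) {D : ℝ}
    (hy : Measurable y) (hD : ∀ s ∈ Set.Icc (0 : ℝ) 1, |y s| ≤ D) {t : ℝ}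
    (ht : t ∈ Set.Icc (0 : ℝ) 1) : IntervalIntegrable (fun s => g s * y s) volume 0 t := by
  obtain ⟨C, hC0, hC⟩ := exists_bound_of_continuous hg
  refine (intervalIntegrable_iff_integrableOn_Icc_of_le ht.1).2
    (integrableOn_Icc_of_bounded (C := C * D) (hg.measurable.mul hy).stronglyMeasurable
      fun s hs => ?_)
  have hs' : s ∈ Set.Icc (0 : ℝ) 1 := ⟨hs.1, hs.2.trans ht.2⟩
  rw [norm_mul]
  exact mul_le_mul (hC s hs') (hD s hs') (abs_nonneg _) hC0

/-- The weighted time integrals, written out. -/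
lemma integral_errorWeight_mul (L B : Matrix (Fin n) (Fin n) ℝ) (m : ℕ) {t : ℝ}
    (ht : t ∈ Set.Icc (0 : ℝ) 1) (i j : Fin n) {y : ℝ → ℝ} {D : ℝ} (hy : Measurable y)
    (hD : ∀ s ∈ Set.Icc (0 : ℝ) 1, |y s| ≤ D) :
    ∫ s, errorWeight L B m t i j s * y s ∂(errorMeasure t) =
      B i j * y t + (∫ s in (0 : ℝ)..t, (NormedSpace.exp ((t - s) • L) * (L * B)) i j * y s)
        - 2 * ∑ k ∈ Finset.Icc 1 m, (phiCos k t L * B) i j *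
          (freq k * ∫ s in (0 : ℝ)..1, Real.sin (freq k * s) * y s) := by
  obtain ⟨C, hC⟩ := exists_bound_errorWeight L B m t
  have hCm := (measurable_errorWeight L B m t i j).mul hy
  have hone : (1 : ℝ) ∈ Set.Icc (0 : ℝ) 1 := ⟨zero_le_one, le_rfl⟩
  set g := fun s : ℝ => (NormedSpace.exp ((t - s) • L) * (L * B)) i j
  have hg : Continuous g := continuous_exp_sub_smul_mul_entry L (L * B) t i j
  have hD0 : 0 ≤ D := (abs_nonneg _).trans (hD 1 hone)
  have hint : Integrable (fun s => errorWeight L B m t i j s * y s) (errorMeasure t) := by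
    refine Integrable.of_bound (C := C * D) hCm.aestronglyMeasurable ?_
    filter_upwards [ae_errorMeasure ht] with s hs
    rw [norm_mul]
    exact mul_le_mul (hC i j s hs) (hD s hs) (abs_nonneg _) ((abs_nonneg _).trans (hC i j s hs))
  have hsin (k : ℕ) : IntervalIntegrable (fun s => Real.sin (freq k * s) * y s) volume 0 1 :=
    intervalIntegrable_mul_of_bounded (by fun_prop) hy hD hone
  have hgi : IntegrableOn (fun s => (Set.Iic t).indicator (fun s => g s * y s) s)
      (Set.Ioc (0 : ℝ) 1) :=
    Integrable.indicator ((intervalIntegrable_iff_integrableOn_Ioc_of_le zero_le_one).1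
      (intervalIntegrable_mul_of_bounded hg hy hD hone)) measurableSet_Iic
  have hsumi : IntervalIntegrable (fun s => ∑ k ∈ Finset.Icc 1 m, (phiCos k t L * B) i j *
      (freq k * (Real.sin (freq k * s) * y s))) volume 0 1 := by
    simpa only [← Finset.sum_fn] using IntervalIntegrable.sum (Finset.Icc 1 m) fun k _ =>
      ((hsin k).const_mul (freq k)).const_mul ((phiCos k t L * B) i j)
  rw [errorMeasure] at hint ⊢
  rw [integral_add_measure hint.left_of_add_measure hint.right_of_add_measure, integral_dirac]
  have hB : errorWeight L B m t i j t = B i j := by simp [errorWeight]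
  have hae : ∀ᵐ s ∂(volume.restrict (Set.Ioc (0 : ℝ) 1)), errorWeight L B m t i j s * y s =
      (Set.Iic t).indicator (fun s => g s * y s) s - 2 * ∑ k ∈ Finset.Icc 1 m,
        (phiCos k t L * B) i j * (freq k * (Real.sin (freq k * s) * y s)) := by
    have : ∀ᵐ s ∂(volume.restrict (Set.Ioc (0 : ℝ) 1)), s ≠ t :=
      ae_restrict_of_ae (Measure.ae_ne volume t)
    filter_upwards [this] with s hs
    rw [errorWeight, if_neg hs, sub_mul, Set.indicator_apply, ite_mul, zero_mul, mul_assoc,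
      Finset.sum_mul]
    simp only [Set.mem_Iic, mul_assoc, g]
  have hinter : Set.Ioc (0 : ℝ) 1 ∩ Set.Iic t = Set.Ioc 0 t := by
    rw [Set.Ioc_inter_Iic, min_eq_right ht.2]
  rw [integral_congr_ae hae, integral_sub hgi
    (((intervalIntegrable_iff_integrableOn_Ioc_of_le zero_le_one).1 hsumi).const_mul 2),
    setIntegral_indicator measurableSet_Iic, hinter, ← intervalIntegral.integral_of_le ht.1,
    integral_const_mul, ← intervalIntegral.integral_of_le zero_le_one,
    intervalIntegral.integral_finsetSum fun k _ => ((hsin k).const_mul _).const_mul _, hB]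
  simp only [intervalIntegral.integral_const_mul]
  ring

lemma integral_mul_indicator_le {g : ℝ → ℝ} {v b : ℝ} (hv : 0 < v) (hb : 0 ≤ b) :
    ∫ s in (0 : ℝ)..b, g s * (if v ≤ s then 1 else 0) =
      if v ≤ b then ∫ s in v..b, g s else 0 := by
  have h (s : ℝ) : g s * (if v ≤ s then 1 else 0) = (Set.Ici v).indicator g s := by
    rw [Set.indicator_apply]
    simp only [Set.mem_Ici]
    split_ifs <;> simp
  simp only [h]
  rw [intervalIntegral.integral_of_le hb, setIntegral_indicator measurableSet_Ici]
  have h2 : Set.Ioc 0 b ∩ Set.Ici v = Set.Icc v b := by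
    ext s
    simp only [Set.mem_inter_iff, Set.mem_Ioc, Set.mem_Ici, Set.mem_Icc]
    exact ⟨fun h => ⟨h.2, h.1.2⟩, fun h => ⟨⟨hv.trans_le h.1, h.2⟩, h.1⟩⟩
  rw [h2]
  split_ifs with hvb
  · rw [intervalIntegral.integral_of_le hvb, integral_Icc_eq_integral_Ioc]
  · rw [Set.Icc_eq_empty hvb, Measure.restrict_empty, integral_zero_measure]

lemma cos_freq (k : ℕ) : Real.cos (freq k) = 0 := by
  rw [Real.cos_eq_zero_iff]
  refine ⟨(k : ℤ) - 1, ?_⟩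
  simp only [freq]; push_cast; ring

/-- The total weight of the times after `v` is the remainder of the cosine expansion of the kernel
`v ↦ e^{(t-v)L} B` of the solution. -/
lemma integral_errorWeight_tail (L B : Matrix (Fin n) (Fin n) ℝ) (m : ℕ) {t : ℝ}
    (ht : t ∈ Set.Icc (0 : ℝ) 1) (i j : Fin n) {v : ℝ} (hv : 0 < v) (hv1 : v ≤ 1) :
    ∫ s, errorWeight L B m t i j s * (if v ≤ s then 1 else 0) ∂(errorMeasure t) =
      (if v ≤ t then (NormedSpace.exp ((t - v) • L) * B) i j else 0)
        - 2 * ∑ k ∈ Finset.Icc 1 m, (phiCos k t L * B) i j * Real.cos (freq k * v) := by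
  rw [integral_errorWeight_mul L B m ht i j (D := 1) (y := fun s => if v ≤ s then 1 else 0)
    (Measurable.ite measurableSet_Ici measurable_const measurable_const)
    (fun s _ => by split_ifs <;> simp)]
  rw [integral_mul_indicator_le hv ht.1]
  congr 1
  · split_ifs with hvt
    · have hd (s : ℝ) : HasDerivAt (fun s : ℝ => -(NormedSpace.exp ((t - s) • L) * B) i j)
          ((NormedSpace.exp ((t - s) • L) * (L * B)) i j) s := by
        have := (hasDerivAt_exp_sub_smul_mul_entry L B t s i j).fun_neg
        simpa [Matrix.mul_assoc] using this
      rw [intervalIntegral.integral_eq_sub_of_hasDerivAt (fun s _ => hd s)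
        ((continuous_exp_sub_smul_mul_entry L (L * B) t i j).intervalIntegrable _ _)]
      simp
    · simp
  · congr 1
    refine Finset.sum_congr rfl fun k hk => ?_
    have hk0 := (freq_pos (Finset.mem_Icc.1 hk).1).ne'
    rw [integral_mul_indicator_le hv zero_le_one, if_pos hv1,
      intervalIntegral.integral_comp_mul_left _ hk0, integral_sin, mul_one, cos_freq, smul_eq_mul]
    field_simp
    ring

/-- Second moments of the entries of the truncation error: Parseval's identity for the kernel. -/
theorem hasSum_integral_errorWeight_tail {L : Matrix (Fin n) (Fin n) ℝ} (hL : NegSemidef L)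
    (B : Matrix (Fin n) (Fin n) ℝ) (m : ℕ) {t : ℝ} (ht : t ∈ Set.Icc (0 : ℝ) 1) (i j : Fin n) :
    HasSum (fun l : ℕ => 2 * (phiCos (m + 1 + l) t L * B) i j ^ 2)
      (∫ v in (0 : ℝ)..1, (∫ s, errorWeight L B m t i j s * (if v ≤ s then 1 else 0)
        ∂(errorMeasure t)) ^ 2) := by
  set f : ℝ → ℝ := fun v => if v ≤ t then (NormedSpace.exp ((t - v) • L) * B) i j else 0 with hf
  have hcont := continuous_exp_sub_smul_mul_entry L B t i j
  obtain ⟨C, hC0, hC⟩ := exists_bound_of_continuous hcont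
  have hP := hasSum_sq_cosCoeff_tail (f := f) (C := C)
    (Measurable.ite measurableSet_Iic hcont.measurable measurable_const)
    (fun s hs => by
      simp only [hf]
      split_ifs
      · exact hC s hs
      · simpa using hC0)
    (c := fun k => (phiCos k t L * B) i j)
    (fun k hk => by
      rw [← integral_cos_mul_exp_entry hL B hk, intervalIntegral.integral_of_le zero_le_one,
        intervalIntegral.integral_of_le ht.1]
      have : ∀ s : ℝ, f s * Real.cos (freq k * s) = (Set.Iic t).indicator
          (fun s => (NormedSpace.exp ((t - s) • L) * B) i j * Real.cos (freq k * s)) s :=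
        fun s => by
          rw [Set.indicator_apply]
          simp only [hf, ite_mul, zero_mul, Set.mem_Iic]
      simp only [this]
      rw [setIntegral_indicator measurableSet_Iic, Set.Ioc_inter_Iic, min_eq_right ht.2])
    m
  convert hP using 1
  refine intervalIntegral.integral_congr_ae (ae_of_all _ fun v hv => ?_)
  rw [Set.uIoc_of_le zero_le_one] at hv
  rw [integral_errorWeight_tail L B m ht i j hv.1 hv.2]

end Solution

/-! ### The mean square error -/

section Error

variable {n : ℕ}

lemma act_apply (A : Matrix (Fin n) (Fin n) ℝ) (v : EuclideanSpace ℝ (Fin n)) (i : Fin n) :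
    act A v i = A.mulVec v.ofLp i := rfl

lemma continuous_act (A : Matrix (Fin n) (Fin n) ℝ) : Continuous (act A) := by
  refine (PiLp.continuous_toLp 2 _).comp (continuous_pi fun i => ?_)
  simp only [Matrix.mulVec, dotProduct]
  fun_prop

lemma intervalIntegral_apply {g : ℝ → EuclideanSpace ℝ (Fin n)} (hg : Continuous g) (a b : ℝ)
    (i : Fin n) : (∫ s in a..b, g s) i = ∫ s in a..b, g s i :=
  ((EuclideanSpace.proj (𝕜 := ℝ) i).intervalIntegral_comp_comm (hg.intervalIntegrable a b)).symm

/-- The truncation error is, coordinate by coordinate, a sum of weighted time integrals of the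
coordinates of the Wiener process. -/
theorem sub_truncation_apply {Ω : Type*} [MeasurableSpace Ω] {P : Measure Ω}
    {L B : Matrix (Fin n) (Fin n) ℝ} {W X : ℝ≥0 → Ω → EuclideanSpace ℝ (Fin n)}
    (hW : IsWienerProcess W P) (hX : IsSolution L B W X P) {w : Fin n → ℝ → Ω → ℝ}
    (hw : ∀ᵐ ω ∂P, ∀ j s, w j s ω = W s.toNNReal ω j) {t : ℝ≥0} (ht : (t : ℝ) ∈ Set.Icc (0 : ℝ) 1)
    (m : ℕ) : ∀ᵐ ω ∂P, ∀ i, (X t ω - truncation L B W X m t ω) i =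
      ∑ j, ∫ s, errorWeight L B m t i j s * w j s ω ∂(errorMeasure t) := by
  have hW0 : ∀ᵐ ω ∂P, ∀ j, W 0 ω j = 0 :=
    ae_all_iff.2 fun j => (hW.brownian j).eval_zero_ae_eq_zero
  have hWc : ∀ᵐ ω ∂P, ∀ j, Continuous fun t => W t ω j :=
    ae_all_iff.2 fun j => (hW.brownian j).cont
  filter_upwards [hW0, hWc, hw, hX] with ω h0 hc hwω ⟨hXc, hXe⟩ i
  have hwc (j : Fin n) : Continuous fun s => w j s ω := by
    simp only [hwω]
    exact (hc j).comp continuous_real_toNNReal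
  have hWc' : Continuous fun s : ℝ => W s.toNNReal ω :=
    (PiLp.continuous_toLp 2 _).comp (continuous_pi fun j => (hc j).comp continuous_real_toNNReal)
  have hXc' : Continuous fun s : ℝ => X s.toNNReal ω := hXc.comp continuous_real_toNNReal
  have hvar := eq_variation_of_constants L B (x := fun s => (X s.toNNReal ω).ofLp)
    (w := fun s j => w j s ω) ((PiLp.continuous_ofLp 2 _).comp hXc')
    (continuous_pi hwc) (fun s hs i => by
      have h := congrArg (fun v : EuclideanSpace ℝ (Fin n) => v i) (hXe s.toNNReal)
      simp only [PiLp.add_apply] at h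
      rw [intervalIntegral_apply (g := fun s => act L (X s.toNNReal ω))
        ((continuous_act L).comp hXc'), Real.coe_toNNReal _ hs] at h
      have h2 : (W s.toNNReal ω - W 0 ω).ofLp = fun j => w j s ω := by
        ext j
        rw [PiLp.sub_apply, h0, sub_zero, hwω]
      simp only [act_apply, h2] at h
      simpa using h) ht.1 i
  have hkl (k : ℕ) (j : Fin n) : klCoeff W k ω j =
      √2 * (freq k * ∫ s in (0 : ℝ)..1, Real.sin (freq k * s) * w j s ω) := by
    have hs : Continuous fun s : ℝ => √2 * Real.sin (freq k * s) := by fun_prop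
    rw [klCoeff, PiLp.smul_apply, intervalIntegral_apply (hs.fun_smul hWc'), smul_eq_mul]
    simp only [PiLp.smul_apply, smul_eq_mul, mul_assoc, intervalIntegral.integral_const_mul, hwω]
    ring
  have htr : truncation L B W X m t ω i =
      (NormedSpace.exp ((t : ℝ) • L)).mulVec (X 0 ω).ofLp i +
      ∑ j, 2 * ∑ k ∈ Finset.Icc 1 m, (phiCos k t L * B) i j *
        (freq k * ∫ s in (0 : ℝ)..1, Real.sin (freq k * s) * w j s ω) := by
    rw [truncation, PiLp.add_apply, act_apply, PiLp.smul_apply, WithLp.ofLp_sum, Finset.sum_apply]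
    simp only [act_apply, Matrix.mulVec, dotProduct, hkl, smul_eq_mul]
    congr 1
    rw [Finset.sum_comm, Finset.mul_sum]
    refine Finset.sum_congr rfl fun j _ => ?_
    rw [Finset.mul_sum, Finset.mul_sum]
    refine Finset.sum_congr rfl fun k _ => ?_
    rw [mul_left_comm _ (√2), ← mul_assoc, Real.mul_self_sqrt zero_le_two]
  simp only [Real.toNNReal_coe, Real.toNNReal_zero] at hvar
  rw [PiLp.sub_apply, htr, hvar, add_sub_add_left_eq_sub, ← Finset.sum_sub_distrib]
  refine Finset.sum_congr rfl fun j _ => ?_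
  obtain ⟨D, -, hD⟩ := exists_bound_of_continuous (hwc j)
  exact (integral_errorWeight_mul L B m ht i j (hwc j).measurable hD).symm

/-- The mean square truncation error is finite and equals the tail of the series. -/
theorem hasSum_integral_norm_sq {Ω : Type*} [MeasurableSpace Ω] {P : Measure Ω}
    [IsProbabilityMeasure P] {L B : Matrix (Fin n) (Fin n) ℝ} (hL : NegSemidef L)
    {W X : ℝ≥0 → Ω → EuclideanSpace ℝ (Fin n)}
    (hW : IsWienerProcess W P) (hX : IsSolution L B W X P) {t : ℝ≥0} (ht : t ≤ 1) (m : ℕ) :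
    Integrable (fun ω => ‖X t ω - truncation L B W X m t ω‖ ^ 2) P ∧
    HasSum (fun j : ℕ => 2 * frobeniusNorm (phiCos (m + 1 + j) t L * B) ^ 2)
      (∫ ω, ‖X t ω - truncation L B W X m t ω‖ ^ 2 ∂P) := by
  have ht' : (t : ℝ) ∈ Set.Icc (0 : ℝ) 1 := ⟨t.2, by exact_mod_cast ht⟩
  obtain ⟨w, hwm, hw2, hcov, hw⟩ := hW.exists_version
  obtain ⟨C, hC⟩ := exists_bound_errorWeight L B m t
  set J : Fin n → Fin n → Ω → ℝ :=
    fun i j ω => ∫ s, errorWeight L B m t i j s * w j s ω ∂(errorMeasure t)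
  have hsq (i j : Fin n) := integral_sq_integral_of_covariance (ae_errorMeasure ht') (hwm j)
    (fun s _ => hw2 j s) (fun s hs u hu => by rw [hcov j j s u hs.1 hu.1, if_pos rfl])
    (measurable_errorWeight L B m t i j) (hC i j)
  have hsq1 (j : Fin n) (s : ℝ) (hs : s ∈ Set.Icc (0 : ℝ) 1) :
      MemLp (w j s) 2 P ∧ ∫ ω, w j s ω ^ 2 ∂P ≤ 1 := by
    refine ⟨hw2 j s, ?_⟩
    have := hcov j j s s hs.1 hs.1
    simp only [← pow_two, min_self, if_true] at this
    rw [this]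
    exact hs.2
  have hoff (i j l : Fin n) (hjl : j ≠ l) := integral_mul_integral_eq_zero (ae_errorMeasure ht')
    (hwm j) (hwm l) (hsq1 j) (hsq1 l)
    (fun s hs u hu => by rw [hcov j l s u hs.1 hu.1, if_neg hjl])
    (measurable_errorWeight L B m t i j) (hC i j) (measurable_errorWeight L B m t i l) (hC i l)
  have hint (i j l : Fin n) : Integrable (fun ω => J i j ω * J i l ω) P := by
    by_cases hjl : j = l
    · subst hjl
      simpa only [← pow_two] using (hsq i j).1
    · exact (hoff i j l hjl).1
  have hae : (fun ω => ‖X t ω - truncation L B W X m t ω‖ ^ 2) =ᵐ[P]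
      fun ω => ∑ i, ∑ j, ∑ l, J i j ω * J i l ω := by
    filter_upwards [sub_truncation_apply hW hX hw ht' m] with ω hω
    rw [EuclideanSpace.norm_sq_eq]
    refine Finset.sum_congr rfl fun i _ => ?_
    rw [Real.norm_eq_abs, sq_abs, hω i, pow_two, Finset.sum_mul_sum]
  have hval : ∫ ω, ‖X t ω - truncation L B W X m t ω‖ ^ 2 ∂P =
      ∑ i, ∑ j, ∫ ω, J i j ω ^ 2 ∂P := by
    rw [integral_congr_ae hae, integral_finsetSum _ fun i _ => integrable_finsetSum _ fun j _ =>
      integrable_finsetSum _ fun l _ => hint i j l]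
    refine Finset.sum_congr rfl fun i _ => ?_
    rw [integral_finsetSum _ fun j _ => integrable_finsetSum _ fun l _ => hint i j l]
    refine Finset.sum_congr rfl fun j _ => ?_
    rw [integral_finsetSum _ fun l _ => hint i j l, Finset.sum_eq_single j]
    · simp only [pow_two]
    · exact fun l _ hl => (hoff i j l hl.symm).2
    · simp
  refine ⟨(integrable_congr hae).2 (integrable_finsetSum _ fun i _ => integrable_finsetSum _
    fun j _ => integrable_finsetSum _ fun l _ => hint i j l), ?_⟩
  rw [hval]
  simp only [frobeniusNorm_sq, Finset.mul_sum]
  refine hasSum_sum fun i _ => hasSum_sum fun j _ => ?_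
  rw [(hsq i j).2]
  exact hasSum_integral_errorWeight_tail hL B m ht' i j

end Error
end SDEKarhunenLoeve

theorem theorem6 {n : ℕ} {Ω : Type*} [MeasurableSpace Ω] (P : Measure Ω) [IsProbabilityMeasure P]
    (L B : Matrix (Fin n) (Fin n) ℝ) (hL : SDEKarhunenLoeve.NegSemidef L)
    (W X : ℝ≥0 → Ω → EuclideanSpace ℝ (Fin n))
    (hW : SDEKarhunenLoeve.IsWienerProcess W P)
    (hX : SDEKarhunenLoeve.IsSolution L B W X P)
    (t : ℝ≥0) (ht : t ≤ 1) :
    (∀ m : ℕ,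
      Integrable (fun ω => ‖X t ω - SDEKarhunenLoeve.truncation L B W X m t ω‖ ^ 2) P ∧
      HasSum
        (fun j : ℕ => 2 * SDEKarhunenLoeve.frobeniusNorm
          (SDEKarhunenLoeve.phiCos (m + 1 + j) t L * B) ^ 2)
        (∫ ω, ‖X t ω - SDEKarhunenLoeve.truncation L B W X m t ω‖ ^ 2 ∂P) ∧
      (2 ≤ m →
        ∫ ω, ‖X t ω - SDEKarhunenLoeve.truncation L B W X m t ω‖ ^ 2 ∂P ≤
          2 * SDEKarhunenLoeve.euclOpNorm B ^ 2 / Real.pi ^ 2 * (n / ((m : ℝ) - 1)))) ∧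
    (fun m : ℕ => ∫ ω, ‖X t ω - SDEKarhunenLoeve.truncation L B W X m t ω‖ ^ 2 ∂P)
      =O[atTop] (fun m : ℕ => 1 / (m : ℝ)) := by
  have hbound (m : ℕ) (hm : 2 ≤ m) :
      ∫ ω, ‖X t ω - SDEKarhunenLoeve.truncation L B W X m t ω‖ ^ 2 ∂P ≤
        2 * SDEKarhunenLoeve.euclOpNorm B ^ 2 / Real.pi ^ 2 * (n / ((m : ℝ) - 1)) :=
    le_of_tendsto' (SDEKarhunenLoeve.hasSum_integral_norm_sq hL hW hX ht m).2.tendsto_sum_nat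
      fun N => SDEKarhunenLoeve.sum_frobeniusNorm_phiCos_le hL B hm t.2 N
  refine ⟨fun m => ⟨(SDEKarhunenLoeve.hasSum_integral_norm_sq hL hW hX ht m).1,
    (SDEKarhunenLoeve.hasSum_integral_norm_sq hL hW hX ht m).2, hbound m⟩, ?_⟩
  refine Asymptotics.IsBigO.of_bound
    (2 * SDEKarhunenLoeve.euclOpNorm B ^ 2 / Real.pi ^ 2 * (2 * n)) ?_
  filter_upwards [eventually_ge_atTop 2] with m hm
  have hm' : (2 : ℝ) ≤ m := by exact_mod_cast hm
  rw [Real.norm_of_nonneg (integral_nonneg fun _ => sq_nonneg _),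
    Real.norm_of_nonneg (by positivity), mul_assoc]
  refine (hbound m hm).trans (mul_le_mul_of_nonneg_left ?_ (by positivity))
  rw [mul_one_div, div_le_div_iff₀ (by linarith) (by linarith)]
  nlinarith [mul_nonneg (n.cast_nonneg : (0 : ℝ) ≤ n) (by linarith : (0 : ℝ) ≤ m - 2)]
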